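/- Let $p\ge 1$, $0<\alpha_1<1$, $\alpha_2:=1-\alpha_1$, let $\mu_1\neq\mu_2$ be vectors in $\mathbb{R}^p$ and let $\Sigma\in\mathbb{R}^{p\times p}$ be symmetric positive definite. Let the pair $(x,y)$ satisfy $y\sim\mathrm{Ber}(\alpha_1)$ and $x\mid y\sim\mathcal{N}_p\{y\mu_1+(1-y)\mu_2,\Sigma\}$, and let $x_1,x_2,\ldots$ be i.i.d. random vectors on a probability space whose common distribution is the marginal distribution of $x$. Put $$\theta:=\Sigma^{-1}(\mu_2-\mu_1),\qquad \beta:=\alpha_1\alpha_2,\qquad \tau:=(\mu_2-\mu_1)'\Sigma^{-1}(\mu_2-\mu_1),$$ and for $u$ in the unit sphere $\mathbb{S}^{p-1}$ define the sample skewness $$\gamma_n(u):=\frac{(1/n)\sum_{i=1}^n\{u'(x_i-\bar x_n)\}^3}{\left[(1/n)\sum_{i=1}^n\{u'(x_i-\bar x_n)\}^2\right]^{3/2}},\qquad \bar x_n:=\frac1n\sum_{i=1}^n x_i .$$ Assume that $\alpha_1\neq 1/2$, and let $u_n$ be any sequence of ($\mathbb{S}^{p-1}$-valued, random) maximizers of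 $u\mapsto\gamma_n(u)^2$ over $\mathbb{S}^{p-1}$; it suffices that $u_n$ is a random vector for every $n$ and that, almost surely, $u_n$ is a maximizer for all sufficiently large $n$. Then there is a sequence of random signs $s_n\in\{-1,1\}$ such that, as $n\to\infty$, 1. $s_nu_n\to\theta/\|\theta\|$ almost surely; 2. $\sqrt n\,(s_nu_n-\theta/\|\theta\|)\rightsquigarrow\mathcal{N}_p(0,\Psi_\gamma)$ in distribution, where $\Psi_\gamma:=C_\gamma\Psi_U$ (a positive semidefinite matrix) with $$\Psi_U:=\left(\frac{1+\beta\tau}{\|\theta\|^2\beta}\right)\left(I_p-\frac{\theta\theta'}{\|\theta\|^2}\right)\Sigma^{-1}\left(I_p-\frac{\theta\theta'}{\|\theta\|^2}\right),\qquad C_\gamma:=\frac{2+6\beta\tau+\beta\tau^2}{\beta\tau^2(1-4\beta)} .$$ -/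

import Mathlib

open MeasureTheory ProbabilityTheory Filter Topology
open scoped Matrix

noncomputable section

namespace SkewnessPP

/-- Vectors of `ℝ^p` with the Euclidean norm. -/
abbrev Vec (p : ℕ) : Type := EuclideanSpace ℝ (Fin p)

/-- The joint law of the pair `(y, x)`: `y ∼ Ber(α₁)` takes the values `0` and `1`
(with `ℙ(y = 1) = α₁`), and `x ∣ y ∼ N_p(y μ₁ + (1 - y) μ₂, S)`. -/
def pairLaw {p : ℕ} (α₁ : unitInterval) (μ₁ μ₂ : Vec p) (S : Matrix (Fin p) (Fin p) ℝ) :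
    Measure (ℕ × Vec p) :=
  (bernoulliMeasure (1 : ℕ) 0 α₁) ⊗ₘ
    (Kernel.ofFunOfCountable
      (fun y : ℕ => multivariateGaussian ((y : ℝ) • μ₁ + (1 - (y : ℝ)) • μ₂) S))

/-- The marginal law of `x` under `pairLaw`. -/
def xLaw {p : ℕ} (α₁ : unitInterval) (μ₁ μ₂ : Vec p) (S : Matrix (Fin p) (Fin p) ℝ) :
    Measure (Vec p) :=
  (pairLaw α₁ μ₁ μ₂ S).snd

/-- The linear discriminant direction `θ = S⁻¹ (μ₂ - μ₁)`. -/
def discriminant {p : ℕ} (μ₁ μ₂ : Vec p) (S : Matrix (Fin p) (Fin p) ℝ) : Vec p :=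
  WithLp.toLp 2 (S⁻¹ *ᵥ (μ₂ - μ₁).ofLp)

/-- The standardized direction `θ / ‖θ‖`. -/
def unitDiscriminant {p : ℕ} (μ₁ μ₂ : Vec p) (S : Matrix (Fin p) (Fin p) ℝ) : Vec p :=
  ‖discriminant μ₁ μ₂ S‖⁻¹ • discriminant μ₁ μ₂ S

/-- The squared Mahalanobis distance `τ = (μ₂ - μ₁)' S⁻¹ (μ₂ - μ₁)`. -/
def mahalanobisSq {p : ℕ} (μ₁ μ₂ : Vec p) (S : Matrix (Fin p) (Fin p) ℝ) : ℝ :=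
  (μ₂ - μ₁).ofLp ⬝ᵥ (S⁻¹ *ᵥ (μ₂ - μ₁).ofLp)

/-- `β = α₁ α₂` with `α₂ = 1 - α₁`. -/
def mixBeta (α₁ : ℝ) : ℝ := α₁ * (1 - α₁)

/-- The projection matrix `I - θ θ' / ‖θ‖²`. -/
def orthProj {p : ℕ} (θ : Vec p) : Matrix (Fin p) (Fin p) ℝ :=
  1 - (‖θ‖ ^ 2)⁻¹ • Matrix.vecMulVec θ.ofLp θ.ofLp

/-- `Ψ_U = ((1 + β τ) / (‖θ‖² β)) (I - θ θ' / ‖θ‖²) S⁻¹ (I - θ θ' / ‖θ‖²)`. -/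
def PsiU {p : ℕ} (α₁ : ℝ) (μ₁ μ₂ : Vec p) (S : Matrix (Fin p) (Fin p) ℝ) :
    Matrix (Fin p) (Fin p) ℝ :=
  ((1 + mixBeta α₁ * mahalanobisSq μ₁ μ₂ S) /
      (‖discriminant μ₁ μ₂ S‖ ^ 2 * mixBeta α₁)) •
    (orthProj (discriminant μ₁ μ₂ S) * S⁻¹ * orthProj (discriminant μ₁ μ₂ S))

/-- `C_γ = (2 + 6 β τ + β τ²) / (β τ² (1 - 4 β))`. -/
def Cgamma (β τ : ℝ) : ℝ :=
  (2 + 6 * β * τ + β * τ ^ 2) / (β * τ ^ 2 * (1 - 4 * β))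

/-- `Ψ_γ = C_γ Ψ_U`. -/
def PsiGamma {p : ℕ} (α₁ : ℝ) (μ₁ μ₂ : Vec p) (S : Matrix (Fin p) (Fin p) ℝ) :
    Matrix (Fin p) (Fin p) ℝ :=
  Cgamma (mixBeta α₁) (mahalanobisSq μ₁ μ₂ S) • PsiU α₁ μ₁ μ₂ S

/-- The sample mean of `x 0, …, x (n - 1)`. -/
def sampleMean {p : ℕ} (x : ℕ → Vec p) (n : ℕ) : Vec p :=
  (n : ℝ)⁻¹ • ∑ i ∈ Finset.range n, x i

/-- The `k`-th central sample moment `(1/n) ∑ᵢ (u'(xᵢ - x̄))^k` of the projections of the first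
`n` observations on `u`. -/
def sampleMoment {p : ℕ} (x : ℕ → Vec p) (n k : ℕ) (u : Vec p) : ℝ :=
  (n : ℝ)⁻¹ * ∑ i ∈ Finset.range n, (inner ℝ u (x i - sampleMean x n)) ^ k

/-- The sample skewness `γ_n(u)` of the projections of the first `n` observations on `u`. -/
def sampleSkewness {p : ℕ} (x : ℕ → Vec p) (n : ℕ) (u : Vec p) : ℝ :=
  sampleMoment x n 3 u / (sampleMoment x n 2 u) ^ (3 / 2 : ℝ)

/-- `u` maximizes `γ_n²` over the unit sphere. -/
def IsSkewnessMaximizer {p : ℕ} (x : ℕ → Vec p) (n : ℕ) (u : Vec p) : Prop :=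
  u ∈ Metric.sphere (0 : Vec p) 1 ∧
    IsMaxOn (fun v => (sampleSkewness x n v) ^ 2) (Metric.sphere (0 : Vec p) 1) u

end SkewnessPP

end

/-!
Among all directions, `θ` maximizes the squared population skewness, uniquely up to scale and sign:
the third moment of the mixture sees `v` only through `⟪Σ θ, v⟫`, and Cauchy–Schwarz for `Σ` bounds
this by the variance. Compactness of the sphere and the law of large numbers then give consistency.

A maximizer `v` is a critical point, so `⟪B v, v⟫ K(v, v) = ⟪K(v, v), v⟫ B v`, where `B` and `K` are
the second and third central sample moments. Let `Γ` be `Σ⁻¹` followed by the projection onto the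
complement of `θ`. Linearizing the image of this equation under `Γ` at `θ / ‖θ‖` shows that
`v - θ / ‖θ‖` is asymptotically a constant multiple of the mean of `w ⟪θ, x i⟫ • Γ (x i)`, where `w`
is a quadratic polynomial. Now `Γ x` and `⟪θ, x⟫` are independent: they are uncorrelated Gaussians
within each component, and `Γ` kills the component means. The covariance in the central limit
theorem therefore splits into the second moment of `w ⟪θ, x⟫`, which produces `C_γ`, and the
covariance of `Γ x`.
-/

namespace SkewnessPP

open InnerProductSpace (rankOne rankOne_apply)
open NormedSpace (normalize norm_normalize_eq_one_iff)

/-- The average of the first `n` terms of `f`; it is `0` at `n = 0`. -/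
noncomputable def avg {E : Type*} [AddCommGroup E] [Module ℝ E] (n : ℕ) (f : ℕ → E) : E :=
  (n : ℝ)⁻¹ • ∑ i ∈ Finset.range n, f i

section avg

variable {E F : Type*} [AddCommGroup E] [Module ℝ E] [AddCommGroup F] [Module ℝ F]

lemma avg_sub (n : ℕ) (f g : ℕ → E) : avg n (fun i => f i - g i) = avg n f - avg n g := by
  simp only [avg, Finset.sum_sub_distrib, smul_sub]

lemma map_avg (L : E →ₗ[ℝ] F) (n : ℕ) (f : ℕ → E) : L (avg n f) = avg n (fun i => L (f i)) := by
  simp only [avg, map_smul, map_sum]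

lemma avg_const_smul (n : ℕ) (c : ℝ) (f : ℕ → E) : avg n (fun i => c • f i) = c • avg n f := by
  simp only [avg, ← Finset.smul_sum, smul_comm c]

lemma avg_smul_const (n : ℕ) (a : ℕ → ℝ) (y : E) : avg n (fun i => a i • y) = avg n a • y := by
  simp only [avg, ← Finset.sum_smul, smul_eq_mul, mul_smul]

lemma avg_const {n : ℕ} (hn : n ≠ 0) (y : E) : avg n (fun _ => y) = y := by
  rw [avg, Finset.sum_const, Finset.card_range, ← Nat.cast_smul_eq_nsmul ℝ,
    inv_smul_smul₀ (Nat.cast_ne_zero.2 hn)]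

lemma avg_smul_sub_avg (n : ℕ) (a : ℕ → ℝ) (z : ℕ → E) :
    avg n (fun i => a i • (z i - avg n z)) = avg n (fun i => (a i - avg n a) • z i) := by
  simp only [smul_sub, sub_smul, avg_sub, avg_smul_const, avg_const_smul]

lemma avg_sub_avg_smul (n : ℕ) (a : ℕ → ℝ) (z : ℕ → E) :
    avg n (fun i => (a i - avg n a) • (z i - avg n z)) =
      avg n (fun i => a i • z i) - avg n a • avg n z := by
  rcases eq_or_ne n 0 with rfl | hn
  · simp [avg]
  · rw [avg_smul_sub_avg, avg_sub n a, avg_const hn, sub_self]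
    simp only [sub_zero, sub_smul, avg_sub, avg_const_smul]

lemma avg_sub_avg_mul_smul (n : ℕ) (a b : ℕ → ℝ) (z : ℕ → E) :
    avg n (fun i => ((a i - avg n a) * (b i - avg n b)) • (z i - avg n z)) =
      avg n (fun i => (a i * b i) • z i) - avg n a • avg n (fun i => b i • z i)
        - avg n b • avg n (fun i => a i • z i) - avg n (fun i => a i * b i) • avg n z
        + (2 * avg n a * avg n b) • avg n z := by
  have hmean : avg n (fun i => (a i - avg n a) * (b i - avg n b)) =
      avg n (fun i => a i * b i) - avg n a * avg n b := avg_sub_avg_smul n a b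
  have hexpand : ∀ i, ((a i - avg n a) * (b i - avg n b) - (avg n (fun i => a i * b i) -
      avg n a * avg n b)) • z i = (a i * b i) • z i - avg n a • b i • z i - avg n b • a i • z i
        - (avg n (fun i => a i * b i) - 2 * avg n a * avg n b) • z i := fun i => by module
  rw [avg_smul_sub_avg, hmean]
  simp only [hexpand, avg_sub, avg_const_smul]
  module

end avg

lemma avg_apply {E F : Type*} [NormedAddCommGroup E] [NormedSpace ℝ E] [NormedAddCommGroup F]
    [NormedSpace ℝ F] (n : ℕ) (f : ℕ → E →L[ℝ] F) (y : E) :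
    avg n f y = avg n (fun i => f i y) := by
  simp only [avg, smul_apply, sum_apply]

section moments

variable {E : Type*} [NormedAddCommGroup E] [InnerProductSpace ℝ E]

lemma inner_avg (n : ℕ) (f : ℕ → E) (y : E) :
    inner ℝ (avg n f) y = avg n (fun i => inner ℝ (f i) y) := by
  simp only [avg, real_inner_smul_left, sum_inner, smul_eq_mul]

/-- The rank one cubic tensor `x ⊗ x ⊗ x`, as the bilinear map `(y, z) ↦ ⟪x, y⟫ ⟪x, z⟫ x`. -/
noncomputable def cube (x : E) : E →L[ℝ] E →L[ℝ] E :=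
  (innerSL ℝ x).smulRight (rankOne ℝ x x)

lemma cube_apply (x y z : E) : cube x y z = (inner ℝ x y * inner ℝ x z) • x := by
  simp [cube, smul_smul]

/-- The sample covariance of the first `n` terms of `x`, as an operator. -/
noncomputable def centralSecond (x : ℕ → E) (n : ℕ) : E →L[ℝ] E :=
  avg n (fun i => rankOne ℝ (x i - avg n x) (x i - avg n x))

/-- The sample third central moment tensor of the first `n` terms of `x`, as a bilinear map. -/
noncomputable def centralThird (x : ℕ → E) (n : ℕ) : E →L[ℝ] E →L[ℝ] E :=
  avg n (fun i => cube (x i - avg n x))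

lemma inner_sub_avg (x : ℕ → E) (n i : ℕ) (y : E) :
    inner ℝ (x i - avg n x) y = inner ℝ (x i) y - avg n (fun j => inner ℝ (x j) y) := by
  rw [inner_sub_left, inner_avg]

lemma centralSecond_apply (x : ℕ → E) (n : ℕ) (y : E) :
    centralSecond x n y = avg n (fun i =>
      (inner ℝ (x i) y - avg n (fun j => inner ℝ (x j) y)) • (x i - avg n x)) := by
  simp only [centralSecond, avg_apply, rankOne_apply, inner_sub_avg]

lemma centralThird_apply (x : ℕ → E) (n : ℕ) (y z : E) :
    centralThird x n y z = avg n (fun i =>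
      ((inner ℝ (x i) y - avg n (fun j => inner ℝ (x j) y)) *
        (inner ℝ (x i) z - avg n (fun j => inner ℝ (x j) z))) • (x i - avg n x)) := by
  simp only [centralThird, avg_apply, cube_apply, inner_sub_avg]

/-- The symmetries of a pair of second and third central moment tensors. -/
structure IsSymmetricMoments (B : E →L[ℝ] E) (K : E →L[ℝ] E →L[ℝ] E) : Prop where
  second_comm : ∀ y z, inner ℝ (B y) z = inner ℝ (B z) y
  third_comm : ∀ y z, K y z = K z y
  inner_third_comm : ∀ y z w, inner ℝ (K y z) w = inner ℝ (K y w) z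

lemma isSymmetricMoments_central (x : ℕ → E) (n : ℕ) :
    IsSymmetricMoments (centralSecond x n) (centralThird x n) where
  second_comm y z := by
    simp only [centralSecond_apply, inner_avg, real_inner_smul_left, inner_sub_avg, mul_comm]
  third_comm y z := by
    simp only [centralThird_apply, mul_comm]
  inner_third_comm y z w := by
    simp only [centralThird_apply, inner_avg, real_inner_smul_left, inner_sub_avg, mul_right_comm]

/-- The first three sample moments of `x` converge to `0`, `T₂` and `T₃`. -/
structure MomentsTendsto (x : ℕ → E) (T₂ : E →L[ℝ] E) (T₃ : E →L[ℝ] E →L[ℝ] E) : Prop where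
  mean : Tendsto (fun n => avg n x) atTop (𝓝 0)
  second : Tendsto (fun n => avg n (fun i => rankOne ℝ (x i) (x i))) atTop (𝓝 T₂)
  third : Tendsto (fun n => avg n (fun i => cube (x i))) atTop (𝓝 T₃)

lemma tendsto_clm_of_apply [FiniteDimensional ℝ E] {ι F : Type*} [NormedAddCommGroup F]
    [NormedSpace ℝ F] {l : Filter ι} {f : ι → E →L[ℝ] F} {T : E →L[ℝ] F}
    (h : ∀ y, Tendsto (fun i => f i y) l (𝓝 (T y))) : Tendsto f l (𝓝 T) := by
  let b := stdOrthonormalBasis ℝ E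
  have hsum (S : E →L[ℝ] F) : ∑ j, (innerSL ℝ (b j)).smulRight (S (b j)) = S := by
    ext y
    conv_rhs => rw [← b.sum_repr' y, map_sum]
    simp
  rw [← hsum T]
  refine Tendsto.congr (fun i => hsum (f i)) (tendsto_finsetSum _ fun j _ => ?_)
  exact ((ContinuousLinearMap.smulRightL ℝ E F (innerSL ℝ (b j))).continuous.tendsto _).comp
    (h (b j))

lemma tendsto_clm_apply {ι F G : Type*} [NormedAddCommGroup F] [NormedSpace ℝ F]
    [NormedAddCommGroup G] [NormedSpace ℝ G] {l : Filter ι} {f : ι → F →L[ℝ] G} {T : F →L[ℝ] G}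
    {v : ι → F} {y : F} (hf : Tendsto f l (𝓝 T)) (hv : Tendsto v l (𝓝 y)) :
    Tendsto (fun i => f i (v i)) l (𝓝 (T y)) :=
  (isBoundedBilinearMap_apply.continuous.tendsto (T, y)).comp (hf.prodMk_nhds hv)

variable {x : ℕ → E} {T₂ : E →L[ℝ] E} {T₃ : E →L[ℝ] E →L[ℝ] E}

lemma MomentsTendsto.tendsto_avg_inner (h : MomentsTendsto x T₂ T₃) (y : E) :
    Tendsto (fun n => avg n (fun i => inner ℝ (x i) y)) atTop (𝓝 0) := by
  simpa only [inner_avg, inner_zero_left] using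
    h.mean.inner (𝕜 := ℝ) (tendsto_const_nhds (x := y))

lemma MomentsTendsto.tendsto_avg_inner_smul (h : MomentsTendsto x T₂ T₃) (y : E) :
    Tendsto (fun n => avg n (fun i => inner ℝ (x i) y • x i)) atTop (𝓝 (T₂ y)) := by
  simpa only [avg_apply, rankOne_apply] using
    tendsto_clm_apply h.second (tendsto_const_nhds (x := y))

variable [FiniteDimensional ℝ E]

lemma MomentsTendsto.tendsto_centralSecond (h : MomentsTendsto x T₂ T₃) :
    Tendsto (centralSecond x) atTop (𝓝 T₂) := by
  refine tendsto_clm_of_apply fun y => ?_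
  simp only [centralSecond_apply, avg_sub_avg_smul]
  simpa using (h.tendsto_avg_inner_smul y).sub ((h.tendsto_avg_inner y).smul h.mean)

lemma MomentsTendsto.tendsto_centralThird (h : MomentsTendsto x T₂ T₃) :
    Tendsto (centralThird x) atTop (𝓝 T₃) := by
  refine tendsto_clm_of_apply fun y => tendsto_clm_of_apply fun z => ?_
  simp only [centralThird_apply, avg_sub_avg_mul_smul]
  have hthird : Tendsto (fun n => avg n fun i => (inner ℝ (x i) y * inner ℝ (x i) z) • x i) atTop
      (𝓝 (T₃ y z)) := by
    simpa only [avg_apply, cube_apply] using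
      tendsto_clm_apply (tendsto_clm_apply h.third tendsto_const_nhds) tendsto_const_nhds
  have hprod : Tendsto (fun n => avg n fun i => inner ℝ (x i) y * inner ℝ (x i) z) atTop
      (𝓝 (inner ℝ (T₂ y) z)) := by
    simpa only [inner_avg, real_inner_smul_left] using
      (h.tendsto_avg_inner_smul y).inner (𝕜 := ℝ) (tendsto_const_nhds (x := z))
  have hy := h.tendsto_avg_inner y
  have hz := h.tendsto_avg_inner z
  simpa using (((hthird.sub (hy.smul (h.tendsto_avg_inner_smul z))).sub
    (hz.smul (h.tendsto_avg_inner_smul y))).sub (hprod.smul h.mean)).add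
    (((hy.const_mul 2).mul hz).smul h.mean)

end moments

section maximizer

variable {E : Type*} [NormedAddCommGroup E] [InnerProductSpace ℝ E]
  {B : E →L[ℝ] E} {K : E →L[ℝ] E →L[ℝ] E} {v : E}

/-- `v` maximizes the squared skewness `⟪K y y, y⟫² / ⟪B y, y⟫³` over all `y`, where `B` and `K`
are second and third central moment tensors. Denominators are cleared, so that no assumption on
the degenerate directions of `B` is needed and the property passes to limits. -/
def IsMaxSkewness (B : E →L[ℝ] E) (K : E →L[ℝ] E →L[ℝ] E) (v : E) : Prop :=
  ∀ y, inner ℝ (K y y) y ^ 2 * inner ℝ (B v) v ^ 3 ≤ inner ℝ (K v v) v ^ 2 * inner ℝ (B y) y ^ 3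

lemma IsMaxSkewness.const_smul (h : IsMaxSkewness B K v) (t : ℝ) : IsMaxSkewness B K (t • v) :=
  fun y => by
    have := mul_le_mul_of_nonneg_left (h y) (by positivity : 0 ≤ t ^ 6)
    simp only [map_smul, smul_apply, real_inner_smul_left, real_inner_smul_right]
    linarith

lemma IsMaxSkewness.of_tendsto {ι : Type*} {l : Filter ι} [l.NeBot] {Bₙ : ι → E →L[ℝ] E}
    {Kₙ : ι → E →L[ℝ] E →L[ℝ] E} {vₙ : ι → E} (hB : Tendsto Bₙ l (𝓝 B)) (hK : Tendsto Kₙ l (𝓝 K))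
    (hv : Tendsto vₙ l (𝓝 v)) (h : ∀ᶠ i in l, IsMaxSkewness (Bₙ i) (Kₙ i) (vₙ i)) :
    IsMaxSkewness B K v := fun y => by
  have hB' {wₙ : ι → E} {w : E} (hw : Tendsto wₙ l (𝓝 w)) :
      Tendsto (fun i => inner ℝ (Bₙ i (wₙ i)) (wₙ i) ^ 3) l (𝓝 (inner ℝ (B w) w ^ 3)) :=
    ((tendsto_clm_apply hB hw).inner hw).pow 3
  have hK' {wₙ : ι → E} {w : E} (hw : Tendsto wₙ l (𝓝 w)) :
      Tendsto (fun i => inner ℝ (Kₙ i (wₙ i) (wₙ i)) (wₙ i) ^ 2) l (𝓝 (inner ℝ (K w w) w ^ 2)) :=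
    ((tendsto_clm_apply (tendsto_clm_apply hK hw) hw).inner hw).pow 2
  have hy : Tendsto (fun _ => y) l (𝓝 y) := tendsto_const_nhds
  exact le_of_tendsto_of_tendsto ((hK' hy).mul (hB' hv)) ((hK' hv).mul (hB' hy))
    (h.mono fun i hi => hi y)

lemma hasDerivAt_inner_apply_add_smul (h : ∀ y z, inner ℝ (B y) z = inner ℝ (B z) y) (v z : E) :
    HasDerivAt (fun t : ℝ => inner ℝ (B (v + t • z)) (v + t • z)) (2 * inner ℝ (B v) z) 0 := by
  have hline : HasDerivAt (fun t : ℝ => v + t • z) z 0 := by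
    simpa using ((hasDerivAt_id (0 : ℝ)).smul_const z).const_add v
  have hderiv := (B.hasFDerivAt.comp_hasDerivAt 0 hline).inner ℝ hline
  convert! hderiv using 1
  simp [h z v, two_mul]

lemma hasDerivAt_inner_apply_apply_add_smul (h : IsSymmetricMoments B K) (v z : E) :
    HasDerivAt (fun t : ℝ => inner ℝ (K (v + t • z) (v + t • z)) (v + t • z))
      (3 * inner ℝ (K v v) z) 0 := by
  have hline : HasDerivAt (fun t : ℝ => v + t • z) z 0 := by
    simpa using ((hasDerivAt_id (0 : ℝ)).smul_const z).const_add v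
  have hderiv := ((K.hasFDerivAt.comp_hasDerivAt 0 hline).clm_apply hline).inner ℝ hline
  convert! hderiv using 1
  simp only [Function.comp_apply, zero_smul, add_zero, inner_add_left, h.third_comm z v,
    h.inner_third_comm v z v]
  ring

lemma IsMaxSkewness.smul_eq_smul (h : IsMaxSkewness B K v)
    (hsymm : IsSymmetricMoments B K) (hb : inner ℝ (B v) v ≠ 0) (hk : inner ℝ (K v v) v ≠ 0) :
    inner ℝ (B v) v • K v v = inner ℝ (K v v) v • B v := by
  refine ext_inner_right ℝ fun z => ?_
  let φ : ℝ → ℝ := fun t =>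
    inner ℝ (K (v + t • z) (v + t • z)) (v + t • z) ^ 2 * inner ℝ (B v) v ^ 3
      - inner ℝ (K v v) v ^ 2 * inner ℝ (B (v + t • z)) (v + t • z) ^ 3
  have hderiv := (((hasDerivAt_inner_apply_apply_add_smul hsymm v z).pow 2).mul_const
    (inner ℝ (B v) v ^ 3)).sub
      (((hasDerivAt_inner_apply_add_smul hsymm.second_comm v z).pow 3).const_mul
        (inner ℝ (K v v) v ^ 2))
  have hmax : IsLocalMax φ 0 := Eventually.of_forall fun t => by
    simpa [φ] using h (v + t • z)
  have hzero := hmax.hasDerivAt_eq_zero hderiv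
  simp only [zero_smul, add_zero] at hzero
  have hfactor : 6 * inner ℝ (K v v) v * inner ℝ (B v) v ^ 2 ≠ 0 := by positivity
  rw [real_inner_smul_left, real_inner_smul_left]
  refine mul_left_cancel₀ hfactor ?_
  linear_combination hzero

end maximizer

section sampleSkewness

variable {p : ℕ} {x : ℕ → Vec p} {n : ℕ} {u v : Vec p}

lemma sampleMoment_eq_avg (x : ℕ → Vec p) (n k : ℕ) (u : Vec p) :
    sampleMoment x n k u = avg n (fun i => inner ℝ (x i - avg n x) u ^ k) := by
  simp only [sampleMoment, fun y => real_inner_comm y u]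
  rfl

lemma sampleMoment_two (x : ℕ → Vec p) (n : ℕ) (u : Vec p) :
    sampleMoment x n 2 u = inner ℝ (centralSecond x n u) u := by
  simp only [sampleMoment_eq_avg, centralSecond_apply, inner_avg, real_inner_smul_left,
    ← inner_sub_avg, ← pow_two]

lemma sampleMoment_three (x : ℕ → Vec p) (n : ℕ) (u : Vec p) :
    sampleMoment x n 3 u = inner ℝ (centralThird x n u u) u := by
  simp only [sampleMoment_eq_avg, centralThird_apply, inner_avg, real_inner_smul_left,
    ← inner_sub_avg, ← pow_two, ← pow_succ]

lemma sampleMoment_smul (x : ℕ → Vec p) (n k : ℕ) (t : ℝ) (u : Vec p) :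
    sampleMoment x n k (t • u) = t ^ k * sampleMoment x n k u := by
  simp only [sampleMoment, real_inner_smul_left, mul_pow, ← Finset.mul_sum]
  ring

lemma sampleMoment_sub_const (x : ℕ → Vec p) (m : Vec p) (n k : ℕ) (u : Vec p) :
    sampleMoment (fun i => x i - m) n k u = sampleMoment x n k u := by
  rcases eq_or_ne n 0 with rfl | hn
  · simp [sampleMoment]
  have hmean : sampleMean (fun i => x i - m) n = sampleMean x n - m :=
    (avg_sub n x fun _ => m).trans (congrArg (avg n x - ·) (avg_const hn m))
  simp only [sampleMoment, hmean, sub_sub_sub_cancel_right]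

lemma sampleMoment_two_nonneg (x : ℕ → Vec p) (n : ℕ) (u : Vec p) : 0 ≤ sampleMoment x n 2 u := by
  unfold sampleMoment
  positivity

lemma sampleMoment_three_eq_zero (h : sampleMoment x n 2 u = 0) : sampleMoment x n 3 u = 0 := by
  rcases mul_eq_zero.1 h with hn | hsum
  · simp [sampleMoment, hn]
  have hterm := (Finset.sum_eq_zero_iff_of_nonneg fun i _ => sq_nonneg _).1 hsum
  refine mul_eq_zero_of_right _ (Finset.sum_eq_zero fun i hi => ?_)
  rw [pow_eq_zero_iff two_ne_zero |>.1 (hterm i hi), zero_pow three_ne_zero]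

lemma sampleSkewness_sq (x : ℕ → Vec p) (n : ℕ) (u : Vec p) :
    sampleSkewness x n u ^ 2 = sampleMoment x n 3 u ^ 2 / sampleMoment x n 2 u ^ 3 := by
  rw [sampleSkewness, div_pow, ← Real.rpow_natCast (_ ^ (3 / 2 : ℝ)),
    ← Real.rpow_mul (sampleMoment_two_nonneg x n u), ← Real.rpow_natCast _ 3]
  norm_num

lemma IsSkewnessMaximizer.sub_const (h : IsSkewnessMaximizer x n v) (m : Vec p) :
    IsSkewnessMaximizer (fun i => x i - m) n v := by
  simpa only [IsSkewnessMaximizer, sampleSkewness, sampleMoment_sub_const] using h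

lemma sampleSkewness_sq_smul {t : ℝ} (ht : t ≠ 0) (x : ℕ → Vec p) (n : ℕ) (u : Vec p) :
    sampleSkewness x n (t • u) ^ 2 = sampleSkewness x n u ^ 2 := by
  simp only [sampleSkewness_sq, sampleMoment_smul]
  field_simp

lemma IsSkewnessMaximizer.isMaxSkewness (h : IsSkewnessMaximizer x n v) :
    IsMaxSkewness (centralSecond x n) (centralThird x n) v := fun y => by
  simp only [← sampleMoment_two, ← sampleMoment_three]
  rcases (sampleMoment_two_nonneg x n v).eq_or_lt with hv | hv
  · have := sampleMoment_two_nonneg x n y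
    rw [← hv, zero_pow three_ne_zero, mul_zero]
    positivity
  rcases (sampleMoment_two_nonneg x n y).eq_or_lt with hy | hy
  · rw [sampleMoment_three_eq_zero hy.symm, ← hy]
    simp
  have hy0 : ‖y‖ ≠ 0 := by
    rintro hy0
    simp [norm_eq_zero.1 hy0, sampleMoment] at hy
  have hle : sampleSkewness x n (‖y‖⁻¹ • y) ^ 2 ≤ sampleSkewness x n v ^ 2 :=
    h.2 (by simp [norm_smul, hy0])
  rwa [sampleSkewness_sq_smul (inv_ne_zero hy0), sampleSkewness_sq, sampleSkewness_sq,
    div_le_div_iff₀ (by positivity) (by positivity)] at hle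

end sampleSkewness

section population

variable {E : Type*} [NormedAddCommGroup E] [InnerProductSpace ℝ E]

/-- `A` is symmetric and positive definite. -/
structure IsPosDef (A : E ≃L[ℝ] E) : Prop where
  symm : ∀ y z, inner ℝ (A y) z = inner ℝ y (A z)
  pos : ∀ y, y ≠ 0 → 0 < inner ℝ (A y) y

/-- The second central moment of a two-component mixture with covariance `A` in both components,
discriminant direction `θ` and product `β` of the weights. The difference of the means is `A θ`. -/
noncomputable def popSecond (A : E ≃L[ℝ] E) (θ : E) (β : ℝ) : E →L[ℝ] E :=
  A + β • rankOne ℝ (A θ) (A θ)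

/-- The third central moment of a two-component mixture, with `c` the third central moment of the
mixing variable. -/
noncomputable def popThird (A : E ≃L[ℝ] E) (θ : E) (c : ℝ) : E →L[ℝ] E →L[ℝ] E :=
  c • cube (A θ)

variable {A : E ≃L[ℝ] E} {θ y z : E} {β c : ℝ}

lemma popSecond_apply (A : E ≃L[ℝ] E) (θ : E) (β : ℝ) (y : E) :
    popSecond A θ β y = A y + (β * inner ℝ (A θ) y) • A θ := by
  simp [popSecond, smul_smul]

lemma popThird_apply (A : E ≃L[ℝ] E) (θ : E) (c : ℝ) (y z : E) :
    popThird A θ c y z = (c * (inner ℝ (A θ) y * inner ℝ (A θ) z)) • A θ := by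
  simp [popThird, cube_apply, smul_smul]

lemma inner_popSecond (A : E ≃L[ℝ] E) (θ : E) (β : ℝ) (y : E) :
    inner ℝ (popSecond A θ β y) y = inner ℝ (A y) y + β * inner ℝ (A θ) y ^ 2 := by
  rw [popSecond_apply, inner_add_left, real_inner_smul_left]
  ring

lemma inner_popThird (A : E ≃L[ℝ] E) (θ : E) (c : ℝ) (y : E) :
    inner ℝ (popThird A θ c y y) y = c * inner ℝ (A θ) y ^ 3 := by
  rw [popThird_apply, real_inner_smul_left]
  ring

lemma IsPosDef.eq_smul_of_mul_le (hA : IsPosDef A) (hθ : θ ≠ 0)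
    (h : inner ℝ (A θ) θ * inner ℝ (A y) y ≤ inner ℝ (A θ) y ^ 2) :
    y = (inner ℝ (A θ) y / inner ℝ (A θ) θ) • θ := by
  have hτ := hA.pos θ hθ
  have hsymm : inner ℝ (A y) θ = inner ℝ (A θ) y := by rw [hA.symm, real_inner_comm]
  set k := inner ℝ (A θ) y / inner ℝ (A θ) θ with hk
  have hres : inner ℝ (A (y - k • θ)) (y - k • θ) =
      (inner ℝ (A θ) θ * inner ℝ (A y) y - inner ℝ (A θ) y ^ 2) / inner ℝ (A θ) θ := by
    simp only [map_sub, map_smul, inner_sub_left, inner_sub_right, real_inner_smul_left,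
      real_inner_smul_right, hsymm, hk]
    field_simp
    ring
  by_contra hne
  have hpos := hA.pos _ (sub_ne_zero.2 hne)
  rw [hres] at hpos
  exact hpos.not_ge (div_nonpos_of_nonpos_of_nonneg (by linarith) hτ.le)

lemma IsPosDef.eq_smul_of_isMaxSkewness (hA : IsPosDef A) (hθ : θ ≠ 0) (hc : c ≠ 0)
    (hy : IsMaxSkewness (popSecond A θ β) (popThird A θ c) y) :
    y = (inner ℝ (A θ) y / inner ℝ (A θ) θ) • θ := by
  have hτ := hA.pos θ hθ
  refine hA.eq_smul_of_mul_le hθ ?_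
  have hle := hy θ
  simp only [inner_popSecond, inner_popThird] at hle
  set τ := inner ℝ (A θ) θ
  set s := inner ℝ (A θ) y
  have hcube : (τ ^ 2 * (inner ℝ (A y) y + β * s ^ 2)) ^ 3 ≤ (s ^ 2 * (τ + β * τ ^ 2)) ^ 3 := by
    refine le_of_mul_le_mul_left ?_ (pow_pos (abs_pos.2 hc) 2)
    rw [sq_abs]
    linarith
  have hcancel := (show Odd 3 by decide).strictMono_pow.le_iff_le.1 hcube
  refine le_of_mul_le_mul_left ?_ hτ
  linarith

lemma IsPosDef.eq_normalize_of_isMaxSkewness (hA : IsPosDef A) (hθ : θ ≠ 0) (hc : c ≠ 0)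
    (hmax : IsMaxSkewness (popSecond A θ β) (popThird A θ c) y) (hy : ‖y‖ = 1)
    (hpos : 0 ≤ inner ℝ y (normalize θ)) : y = normalize θ := by
  obtain ⟨k, rfl⟩ : ∃ k : ℝ, y = k • θ := ⟨_, hA.eq_smul_of_isMaxSkewness hθ hc hmax⟩
  have hnorm := norm_pos_iff.2 hθ
  have hk : 0 ≤ k := by
    rw [NormedSpace.normalize, real_inner_smul_left, real_inner_smul_right] at hpos
    exact nonneg_of_mul_nonneg_left hpos
      (mul_pos (inv_pos.2 hnorm) (real_inner_self_pos.2 hθ))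
  rw [norm_smul, Real.norm_of_nonneg hk] at hy
  rw [NormedSpace.normalize, eq_inv_of_mul_eq_one_left hy]

theorem IsPosDef.tendsto_normalize_of_isMaxSkewness [FiniteDimensional ℝ E] {l : Filter ℕ}
    {B : ℕ → E →L[ℝ] E} {K : ℕ → E →L[ℝ] E →L[ℝ] E} {v : ℕ → E} (hA : IsPosDef A) (hθ : θ ≠ 0)
    (hc : c ≠ 0) (hB : Tendsto B l (𝓝 (popSecond A θ β))) (hK : Tendsto K l (𝓝 (popThird A θ c)))
    (hmax : ∀ᶠ n in l, IsMaxSkewness (B n) (K n) (v n)) (hv : ∀ᶠ n in l, ‖v n‖ = 1)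
    (hpos : ∀ᶠ n in l, 0 ≤ inner ℝ (v n) (normalize θ)) :
    Tendsto v l (𝓝 (normalize θ)) := by
  have hcompact : IsCompact (Metric.sphere (0 : E) 1 ∩ {y | 0 ≤ inner ℝ y (normalize θ)}) :=
    (isCompact_sphere _ _).inter_right (isClosed_le continuous_const (by fun_prop))
  refine hcompact.tendsto_nhds_of_unique_mapClusterPt ?_ ?_
  · filter_upwards [hv, hpos] with n h1 h2 using ⟨by simpa using h1, h2⟩
  · rintro y ⟨hy, hy0⟩ hcluster
    obtain ⟨U, hU, hUy⟩ := mapClusterPt_iff_ultrafilter.1 hcluster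
    exact hA.eq_normalize_of_isMaxSkewness hθ hc (.of_tendsto (hB.mono_left hU)
      (hK.mono_left hU) hUy (hmax.filter_mono hU)) (by simpa using hy) hy0

end population

section linearization

open Asymptotics

variable {E : Type*} [NormedAddCommGroup E] [InnerProductSpace ℝ E]
  {A : E ≃L[ℝ] E} {θ v : E} {β c : ℝ}

/-- The inverse of `A` followed by the orthogonal projection off the direction `θ`. -/
noncomputable def projInv (A : E ≃L[ℝ] E) (θ : E) : E →L[ℝ] E :=
  (ℝ ∙ θ)ᗮ.starProjection ∘L A.symm

lemma projInv_apply (A : E ≃L[ℝ] E) (θ y : E) : projInv A θ (A y) = (ℝ ∙ θ)ᗮ.starProjection y := by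
  simp [projInv]

lemma projInv_apply_self (A : E ≃L[ℝ] E) (θ : E) : projInv A θ (A θ) = 0 := by
  simp [projInv_apply, Submodule.starProjection_orthogonal_val,
    Submodule.starProjection_eq_self_iff.2 (Submodule.mem_span_singleton_self θ)]

lemma IsPosDef.inner_projInv (hA : IsPosDef A) (θ t x : E) :
    inner ℝ t (projInv A θ x) = inner ℝ (A.symm ((ℝ ∙ θ)ᗮ.starProjection t)) x := by
  calc inner ℝ t (projInv A θ x) = inner ℝ ((ℝ ∙ θ)ᗮ.starProjection t) (A.symm x) :=
        ((ℝ ∙ θ)ᗮ.starProjection_isSymmetric t _).symm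
    _ = inner ℝ (A.symm ((ℝ ∙ θ)ᗮ.starProjection t)) x := by
        rw [← A.apply_symm_apply ((ℝ ∙ θ)ᗮ.starProjection t), hA.symm]
        rw [A.apply_symm_apply, A.apply_symm_apply]

lemma starProjection_orthogonal_singleton (θ y : E) :
    (ℝ ∙ θ)ᗮ.starProjection y = y - ((‖θ‖ ^ 2)⁻¹ * inner ℝ θ y) • θ := by
  rw [Submodule.starProjection_orthogonal_val, Submodule.starProjection_singleton,
    inv_mul_eq_div, RCLike.ofReal_real_eq_id, id]

lemma starProjection_orthogonal_sub_normalize (hθ : θ ≠ 0) (hv : ‖v‖ = 1) :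
    (ℝ ∙ θ)ᗮ.starProjection (v - normalize θ) =
      (v - normalize θ) + (‖v - normalize θ‖ ^ 2 / 2) • normalize θ := by
  have hu : ‖normalize θ‖ = 1 := norm_normalize_eq_one_iff.2 hθ
  have hinner : inner ℝ (normalize θ) (v - normalize θ) = -(‖v - normalize θ‖ ^ 2 / 2) := by
    rw [norm_sub_sq_real, inner_sub_right, real_inner_self_eq_norm_sq, hv, hu, real_inner_comm]
    ring
  rw [starProjection_orthogonal_singleton, ← neg_neg (_ ^ 2 / 2), ← hinner]
  simp only [NormedSpace.normalize, real_inner_smul_left, smul_smul]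
  match_scalars <;> ring

/-- The leading term of `v - normalize θ`, up to a constant factor, when `v` maximizes the squared
skewness with moment tensors `B` and `K`. -/
noncomputable def score (A : E ≃L[ℝ] E) (θ : E) (B : E →L[ℝ] E) (K : E →L[ℝ] E →L[ℝ] E) (v : E) :
    E :=
  projInv A θ (inner ℝ (B v) v • K (normalize θ) (normalize θ)
    - inner ℝ (K v v) v • B (normalize θ))

/-- The linear map sending `v - normalize θ` to `score A θ B K v` at a critical point `v`. -/
noncomputable def scoreMap (A : E ≃L[ℝ] E) (θ : E) (B : E →L[ℝ] E) (K : E →L[ℝ] E →L[ℝ] E) (v : E) :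
    E →L[ℝ] E :=
  projInv A θ ∘L (inner ℝ (K v v) v • B - inner ℝ (B v) v • (K (normalize θ) + K v))

lemma score_eq_scoreMap {B : E →L[ℝ] E} {K : E →L[ℝ] E →L[ℝ] E} (hsymm : IsSymmetricMoments B K)
    (hmax : IsMaxSkewness B K v) (hb : inner ℝ (B v) v ≠ 0) (hk : inner ℝ (K v v) v ≠ 0) :
    score A θ B K v = scoreMap A θ B K v (v - normalize θ) := by
  have hcritical := hmax.smul_eq_smul hsymm hb hk
  rw [score, scoreMap, ContinuousLinearMap.comp_apply]
  congr 1
  simp only [sub_apply, smul_apply, add_apply, map_sub, hsymm.third_comm v (normalize θ), smul_add,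
    hcritical]
  abel

lemma projInv_comp_popSecond (A : E ≃L[ℝ] E) (θ : E) (β : ℝ) :
    projInv A θ ∘L popSecond A θ β = (ℝ ∙ θ)ᗮ.starProjection := by
  ext1 y
  simp [popSecond_apply, projInv_apply_self, projInv_apply]

lemma projInv_comp_popThird (A : E ≃L[ℝ] E) (θ : E) (c : ℝ) (y : E) :
    projInv A θ ∘L popThird A θ c y = 0 := by
  ext1 z
  simp [popThird_apply, projInv_apply_self]

lemma isLittleO_clm_apply {ι F G : Type*} [NormedAddCommGroup F] [NormedSpace ℝ F]
    [NormedAddCommGroup G] [NormedSpace ℝ G] {l : Filter ι} {T : ι → F →L[ℝ] G}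
    (hT : Tendsto T l (𝓝 0)) (d : ι → F) : (fun i => T i (d i)) =o[l] d := by
  have hmul : (fun i => ‖T i‖ * ‖d i‖) =o[l] fun i => ‖d i‖ := by
    simpa using ((isLittleO_one_iff ℝ).2 (tendsto_zero_iff_norm_tendsto_zero.1 hT)).mul_isBigO
      (isBigO_refl (fun i => ‖d i‖) l)
  exact (IsBigO.of_norm_le fun i => (T i).le_opNorm (d i)).trans_isLittleO hmul.of_norm_right

/-- The variance of the population projected on `normalize θ`. -/
noncomputable def popVar (A : E ≃L[ℝ] E) (θ : E) (β : ℝ) : ℝ :=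
  inner ℝ (popSecond A θ β (normalize θ)) (normalize θ)

/-- The third central moment of the population projected on `normalize θ`. -/
noncomputable def popSkew (A : E ≃L[ℝ] E) (θ : E) (c : ℝ) : ℝ :=
  inner ℝ (popThird A θ c (normalize θ) (normalize θ)) (normalize θ)

lemma popVar_eq (A : E ≃L[ℝ] E) (θ : E) (β : ℝ) :
    popVar A θ β = (inner ℝ (A θ) θ + β * inner ℝ (A θ) θ ^ 2) / ‖θ‖ ^ 2 := by
  simp only [popVar, inner_popSecond, NormedSpace.normalize, map_smul, real_inner_smul_left,
    real_inner_smul_right]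
  ring

lemma popSkew_eq (A : E ≃L[ℝ] E) (θ : E) (c : ℝ) :
    popSkew A θ c = c * (inner ℝ (A θ) θ / ‖θ‖) ^ 3 := by
  rw [popSkew, inner_popThird, NormedSpace.normalize, real_inner_smul_right]
  ring

lemma IsPosDef.popVar_pos (hA : IsPosDef A) (hθ : θ ≠ 0) (hβ : 0 ≤ β) : 0 < popVar A θ β := by
  have hτ := hA.pos θ hθ
  rw [popVar_eq]
  positivity

lemma IsPosDef.popSkew_ne_zero (hA : IsPosDef A) (hθ : θ ≠ 0) (hc : c ≠ 0) :
    popSkew A θ c ≠ 0 := by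
  rw [popSkew_eq]
  exact mul_ne_zero hc (pow_ne_zero _ (div_ne_zero (hA.pos θ hθ).ne' (norm_ne_zero_iff.2 hθ)))

variable {ι : Type*} {l : Filter ι} {B : ι → E →L[ℝ] E} {K : ι → E →L[ℝ] E →L[ℝ] E} {w : ι → E}

lemma tendsto_scoreMap (hB : Tendsto B l (𝓝 (popSecond A θ β)))
    (hK : Tendsto K l (𝓝 (popThird A θ c))) (hw : Tendsto w l (𝓝 (normalize θ))) :
    Tendsto (fun i => scoreMap A θ (B i) (K i) (w i)) l
      (𝓝 (popSkew A θ c • (ℝ ∙ θ)ᗮ.starProjection)) := by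
  have hb := (tendsto_clm_apply hB hw).inner (𝕜 := ℝ) hw
  have hKw := tendsto_clm_apply hK hw
  have hk := (tendsto_clm_apply hKw hw).inner (𝕜 := ℝ) hw
  have hlim := (hk.smul hB).sub
    (hb.smul ((tendsto_clm_apply hK (tendsto_const_nhds (x := normalize θ))).add hKw))
  have hcomp := ((ContinuousLinearMap.compL ℝ E E E (projInv A θ)).continuous.tendsto _).comp hlim
  convert! hcomp using 2
  simp [popSkew, projInv_comp_popSecond, projInv_comp_popThird, ContinuousLinearMap.comp_sub,
    ContinuousLinearMap.comp_add]

lemma isLittleO_norm_sq_div_two_smul {d : ι → E} (hd : Tendsto d l (𝓝 0)) (u : E) :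
    (fun i => (‖d i‖ ^ 2 / 2) • u) =o[l] d := by
  have hsq : (fun i => ‖d i‖ ^ 2) =o[l] d :=
    (isLittleO_norm_pow_id one_lt_two).comp_tendsto hd
  have hbound : (fun i => (‖d i‖ ^ 2 / 2) • u) =O[l] fun i => ‖d i‖ ^ 2 := by
    refine IsBigO.of_bound (‖u‖ / 2) (Eventually.of_forall fun i => le_of_eq ?_)
    rw [norm_smul, Real.norm_of_nonneg (by positivity), Real.norm_of_nonneg (by positivity)]
    ring
  exact hbound.trans_isLittleO hsq

theorem IsPosDef.isEquivalent_smul_score (hA : IsPosDef A) (hθ : θ ≠ 0) (hβ : 0 ≤ β) (hc : c ≠ 0)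
    (hB : Tendsto B l (𝓝 (popSecond A θ β))) (hK : Tendsto K l (𝓝 (popThird A θ c)))
    (hsymm : ∀ i, IsSymmetricMoments (B i) (K i))
    (hmax : ∀ᶠ i in l, IsMaxSkewness (B i) (K i) (w i)) (hunit : ∀ᶠ i in l, ‖w i‖ = 1)
    (hw : Tendsto w l (𝓝 (normalize θ))) :
    (fun i => w i - normalize θ) ~[l] fun i => (popSkew A θ c)⁻¹ • score A θ (B i) (K i) (w i) := by
  have hk := hA.popSkew_ne_zero hθ hc
  have hb_lim := (tendsto_clm_apply hB hw).inner (𝕜 := ℝ) hw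
  have hk_lim := (tendsto_clm_apply (tendsto_clm_apply hK hw) hw).inner (𝕜 := ℝ) hw
  have hd : Tendsto (fun i => w i - normalize θ) l (𝓝 0) := by
    simpa using hw.sub_const (normalize θ)
  have hscore : ∀ᶠ i in l, score A θ (B i) (K i) (w i) - popSkew A θ c • (w i - normalize θ) =
      (scoreMap A θ (B i) (K i) (w i) - popSkew A θ c • (ℝ ∙ θ)ᗮ.starProjection)
        (w i - normalize θ)
      + popSkew A θ c • (‖w i - normalize θ‖ ^ 2 / 2) • normalize θ := by
    filter_upwards [hmax, hunit, hb_lim.eventually_ne (hA.popVar_pos hθ hβ).ne',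
      hk_lim.eventually_ne hk] with i hi hwi hbi hki
    rw [score_eq_scoreMap (hsymm i) hi hbi hki, sub_apply, smul_apply,
      starProjection_orthogonal_sub_normalize hθ hwi]
    module
  have hsmall : (fun i => score A θ (B i) (K i) (w i) - popSkew A θ c • (w i - normalize θ))
      =o[l] fun i => w i - normalize θ := by
    refine IsLittleO.congr' ?_ (hscore.mono fun _ => Eq.symm) EventuallyEq.rfl
    refine (isLittleO_clm_apply ?_ _).add ((isLittleO_norm_sq_div_two_smul hd _).const_smul_left _)
    simpa using (tendsto_scoreMap hB hK hw).sub_const (popSkew A θ c • (ℝ ∙ θ)ᗮ.starProjection)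
  refine IsEquivalent.symm ((hsmall.const_smul_left (popSkew A θ c)⁻¹).congr_left fun i => ?_)
  rw [Pi.sub_apply, Pi.smul_apply, smul_sub, inv_smul_smul₀ hk]

end linearization

section ConvergenceInDistribution

variable {Ω Ω' : Type*} [MeasurableSpace Ω] {P : Measure Ω} [IsProbabilityMeasure P]
  [MeasurableSpace Ω'] {P' : Measure Ω'} [IsProbabilityMeasure P']

section InnerProductSpace

variable {E : Type*} [NormedAddCommGroup E] [InnerProductSpace ℝ E] [MeasurableSpace E]
  [BorelSpace E]

omit [IsProbabilityMeasure P] in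
lemma charFun_map_inner [SecondCountableTopology E] {W : Ω → E} (hW : AEMeasurable W P) (t : E) :
    charFun (P.map fun ω => inner ℝ t (W ω)) 1 = charFun (P.map W) t := by
  rw [charFun_apply, charFun_apply, integral_map (by fun_prop) (by fun_prop),
    integral_map hW (by fun_prop)]
  simp [real_inner_comm]

variable [FiniteDimensional ℝ E]

theorem tendstoInDistribution_of_forall_inner {X : ℕ → Ω → E} {Z : Ω' → E}
    (hX : ∀ n, AEMeasurable (X n) P) (hZ : AEMeasurable Z P')
    (h : ∀ t, TendstoInDistribution (fun n ω => inner ℝ t (X n ω)) atTop (fun ω => inner ℝ t (Z ω))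
      (fun _ => P) P') :
    TendstoInDistribution X atTop Z (fun _ => P) P' := by
  refine ⟨hX, hZ, ProbabilityMeasure.tendsto_iff_tendsto_charFun.2 fun t => ?_⟩
  have := ProbabilityMeasure.tendsto_iff_tendsto_charFun.1 (h t).tendsto 1
  simpa only [ProbabilityMeasure.coe_mk, charFun_map_inner (hX _), charFun_map_inner hZ] using this

theorem tendstoInDistribution_inv_sqrt_smul_sum {Y : ℕ → Ω → E} (hindep : iIndepFun Y P)
    (hident : ∀ i, IdentDistrib (Y i) (Y 0) P P) (hmem : MemLp (Y 0) 2 P) (hmean : P[Y 0] = 0)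
    {W : Ω' → E} (hW : HasGaussianLaw W P') (hWmean : P'[W] = 0)
    (hvar : ∀ t, Var[fun ω => inner ℝ t (W ω); P'] = Var[fun ω => inner ℝ t (Y 0 ω); P]) :
    TendstoInDistribution (fun (n : ℕ) ω => (√(n : ℝ))⁻¹ • ∑ i ∈ Finset.range n, Y i ω) atTop W
      (fun _ => P) P' := by
  have hYm (i : ℕ) : AEMeasurable (Y i) P := (hident i).aemeasurable_fst
  refine tendstoInDistribution_of_forall_inner (fun n => ?_) hW.aemeasurable fun t => ?_
  · exact (Finset.aemeasurable_fun_sum _ fun i _ => hYm i).fun_const_smul _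
  have hmean_t : ∫ ω, inner ℝ t (Y 0 ω) ∂P = 0 := by
    rw [integral_inner (hmem.integrable one_le_two), hmean, inner_zero_right]
  have hWmean_t : ∫ ω, inner ℝ t (W ω) ∂P' = 0 := by
    rw [integral_inner hW.integrable, hWmean, inner_zero_right]
  have hlaw : HasLaw (fun ω => inner ℝ t (W ω))
      (gaussianReal 0 Var[fun ω => inner ℝ t (Y 0 ω); P].toNNReal) P' := by
    have hgauss : HasGaussianLaw (fun ω => inner ℝ t (W ω)) P' := hW.map_fun (innerSL ℝ t)
    exact ⟨hgauss.aemeasurable, by rw [hgauss.map_eq_gaussianReal, hWmean_t, hvar]⟩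
  have hclt := tendstoInDistribution_inv_sqrt_mul_sum_sub
    (X := fun i ω => inner ℝ t (Y i ω)) hlaw (hmem.const_inner t)
    (hindep.comp (fun _ y => inner ℝ t y) fun _ => by fun_prop)
    fun i => (hident i).comp (u := fun y => inner ℝ t y) (by fun_prop)
  simpa [real_inner_smul_right, inner_sum, hmean_t] using hclt

end InnerProductSpace

section NormedSpace

variable {E : Type*} [NormedAddCommGroup E] [NormedSpace ℝ E] [SecondCountableTopology E]
  [MeasurableSpace E] [BorelSpace E] {X : ℕ → Ω → E} {Z : Ω' → E}

omit [NormedSpace ℝ E] [SecondCountableTopology E] in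
lemma tendstoInMeasure_zero_of_tendstoInDistribution {ι : Type*} {l : Filter ι} {X : ι → Ω → E}
    (h : TendstoInDistribution X l (fun _ : Ω' => (0 : E)) (fun _ => P) P') :
    TendstoInMeasure P X l (0 : Ω → E) := by
  rw [tendstoInMeasure_iff_norm]
  intro ε hε
  have hclosed : IsClosed {x : E | ε ≤ ‖x‖} := isClosed_le continuous_const continuous_norm
  have hlimsup := ProbabilityMeasure.limsup_measure_closed_le_of_tendsto h.tendsto hclosed
  refine tendsto_of_le_liminf_of_limsup_le bot_le ?_
  simpa [Measure.map_apply_of_aemeasurable (h.forall_aemeasurable _) hclosed.measurableSet,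
    hclosed.measurableSet, hε.not_ge] using! hlimsup

omit [NormedSpace ℝ E] in
lemma tendstoInDistribution_of_eventuallyEq {D : ℕ → Ω → E}
    (hX : TendstoInDistribution X atTop Z (fun _ => P) P') (hD : ∀ n, AEMeasurable (D n) P)
    (h : ∀ᵐ ω ∂P, (fun n => D n ω) =ᶠ[atTop] fun n => X n ω) :
    TendstoInDistribution D atTop Z (fun _ => P) P' := by
  refine tendstoInDistribution_of_tendstoInMeasure_sub D Z hX ?_ hD
  refine tendstoInMeasure_of_tendsto_ae
    (fun n => ((hD n).sub (hX.forall_aemeasurable n)).aestronglyMeasurable) ?_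
  filter_upwards [h] with ω hω
  exact tendsto_const_nhds.congr' (hω.mono fun n hn => by simp [hn])

open Asymptotics in
theorem tendstoInDistribution_of_isEquivalent {D : ℕ → Ω → E}
    (hX : TendstoInDistribution X atTop Z (fun _ => P) P') (hD : ∀ n, AEMeasurable (D n) P)
    (h : ∀ᵐ ω ∂P, (fun n => D n ω) ~[atTop] fun n => X n ω) :
    TendstoInDistribution D atTop Z (fun _ => P) P' := by
  have hXm := hX.forall_aemeasurable
  -- The relative error, which vanishes wherever `X n ω` does.
  let q : ℕ → Ω → E := fun n ω => ‖X n ω‖⁻¹ • (D n ω - X n ω)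
  have hqm (n : ℕ) : AEMeasurable (q n) P := (hXm n).norm.inv.smul ((hD n).sub (hXm n))
  have hq : ∀ᵐ ω ∂P, Tendsto (fun n => q n ω) atTop (𝓝 0) :=
    h.mono fun ω hω => hω.isLittleO.norm_right.tendsto_inv_smul_nhds_zero
  have hXq := hX.continuous_comp_prodMk_of_tendstoInMeasure_const
    (g := fun r : E × E => r.1 + ‖r.1‖ • r.2) (by fun_prop)
    (tendstoInMeasure_of_tendsto_ae (fun n => (hqm n).aestronglyMeasurable) hq) hqm
  simp only [smul_zero, add_zero] at hXq
  refine tendstoInDistribution_of_eventuallyEq hXq hD ?_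
  filter_upwards [h] with ω hω
  filter_upwards [hω.isLittleO.isBigO.eq_zero_imp] with n hzero
  rcases eq_or_ne (X n ω) 0 with hX0 | hX0
  · simpa [hX0] using hzero hX0
  · simp [q, smul_inv_smul₀ (norm_ne_zero_iff.2 hX0)]

theorem tendstoInMeasure_zero_smul (hX : TendstoInDistribution X atTop Z (fun _ => P) P')
    {c : ℕ → Ω → ℝ} (hcm : ∀ n, AEMeasurable (c n) P)
    (hc : ∀ᵐ ω ∂P, Tendsto (fun n => c n ω) atTop (𝓝 0)) :
    TendstoInMeasure P (fun n ω => c n ω • X n ω) atTop (0 : Ω → E) := by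
  refine tendstoInMeasure_zero_of_tendstoInDistribution (P' := P') ?_
  have hc' := tendstoInMeasure_of_tendsto_ae (fun n => (hcm n).aestronglyMeasurable) hc
  simpa using hX.continuous_comp_prodMk_of_tendstoInMeasure_const
    (g := fun q : E × ℝ => q.2 • q.1) (by fun_prop) hc' hcm

theorem tendstoInDistribution_sum_smul {κ : Type*} {s : Finset κ} {Y : κ → ℕ → Ω → E}
    {W : κ → Ω' → E} (hY : ∀ j ∈ s, TendstoInDistribution (Y j) atTop (W j) (fun _ => P) P')
    {c : κ → ℕ → Ω → ℝ} {a : κ → ℝ} (hcm : ∀ j ∈ s, ∀ n, AEMeasurable (c j n) P)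
    (hc : ∀ j ∈ s, ∀ᵐ ω ∂P, Tendsto (fun n => c j n ω) atTop (𝓝 (a j)))
    (hlim : TendstoInDistribution (fun n ω => ∑ j ∈ s, a j • Y j n ω) atTop Z (fun _ => P) P') :
    TendstoInDistribution (fun n ω => ∑ j ∈ s, c j n ω • Y j n ω) atTop Z (fun _ => P) P' := by
  suffices h : ∀ t ⊆ s, TendstoInDistribution
      (fun n ω => ∑ j ∈ s, a j • Y j n ω + ∑ j ∈ t, (c j n ω - a j) • Y j n ω) atTop Z
      (fun _ => P) P' by
    simpa [sub_smul] using h s subset_rfl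
  intro t
  induction t using Finset.cons_induction with
  | empty => simpa using fun _ : ∅ ⊆ s => hlim
  | cons j t hj ih =>
    intro hts
    obtain ⟨hjs, hts⟩ := Finset.cons_subset.1 hts
    have hzero : ∀ᵐ ω ∂P, Tendsto (fun n => c j n ω - a j) atTop (𝓝 0) :=
      (hc j hjs).mono fun ω hω => by simpa using hω.sub_const (a j)
    have hcm' (n : ℕ) : AEMeasurable (fun ω => c j n ω - a j) P := (hcm j hjs n).sub_const _
    have hnull : TendstoInMeasure P (fun n ω => (c j n ω - a j) • Y j n ω) atTop fun _ => (0 : E) :=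
      tendstoInMeasure_zero_smul (hY j hjs) hcm' hzero
    have := (ih hts).add_of_tendstoInMeasure_const hnull
      fun n => (hcm' n).smul ((hY j hjs).forall_aemeasurable n)
    simpa [Finset.sum_cons, Pi.add_def, add_left_comm, add_comm] using! this

end NormedSpace

end ConvergenceInDistribution

section Moments

variable {E : Type*} [NormedAddCommGroup E] [MeasurableSpace E] {μ ν : Measure E}

/-- A measure has moments when every power of the norm is integrable, so that every function of
temperate growth is. -/
def HasMoments (ν : Measure E) : Prop :=
  ∀ k : ℕ, Integrable (fun x => ‖x‖ ^ k) ν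

namespace HasMoments

lemma add_measure (hμ : HasMoments μ) (hν : HasMoments ν) : HasMoments (μ + ν) :=
  fun k => (hμ k).add_measure (hν k)

lemma smul_measure (hν : HasMoments ν) (c : NNReal) : HasMoments (c • ν) :=
  fun k => (hν k).smul_measure_nnreal

protected lemma isFiniteMeasure (hν : HasMoments ν) : IsFiniteMeasure ν := by
  simpa [integrable_const_iff] using hν 0

lemma of_isGaussian [NormedSpace ℝ E] [BorelSpace E] [CompleteSpace E]
    [SecondCountableTopology E] (ν : Measure E) [IsGaussian ν] : HasMoments ν := by
  intro k
  rcases eq_or_ne k 0 with rfl | hk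
  · simp
  · exact (IsGaussian.memLp_id ν k (by simp)).integrable_norm_pow hk

variable [NormedSpace ℝ E] [BorelSpace E] [SecondCountableTopology E]
  {F : Type*} [NormedAddCommGroup F]

theorem integrable [NormedSpace ℝ F] (hν : HasMoments ν) {f : E → F}
    (hf : f.HasTemperateGrowth) : Integrable f ν := by
  obtain ⟨k, C, -, hC⟩ := hf.norm_iteratedFDeriv_le_uniform 0
  have := hν.isFiniteMeasure
  have hbound : Integrable (fun x => C * (1 + ‖x‖) ^ k) ν := by
    simp_rw [add_comm (1 : ℝ), add_pow, one_pow, mul_one]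
    exact (integrable_finsetSum _ fun m _ => (hν m).mul_const _).const_mul C
  refine hbound.mono' hf.1.continuous.aestronglyMeasurable (ae_of_all _ fun x => ?_)
  simpa using hC 0 le_rfl x

omit [NormedSpace ℝ E] in
lemma integrable_of_norm_eq_pow (hν : HasMoments ν) {f : E → F} (hf : Continuous f) {k : ℕ}
    (hk : ∀ x, ‖f x‖ = ‖x‖ ^ k) : Integrable f ν := by
  rw [← integrable_norm_iff hf.aestronglyMeasurable]
  simpa only [hk] using hν k

theorem memLp_two [InnerProductSpace ℝ F] (hν : HasMoments ν) {f : E → F}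
    (hf : f.HasTemperateGrowth) : MemLp f 2 ν := by
  rw [memLp_two_iff_integrable_sq_norm hf.1.continuous.aestronglyMeasurable]
  exact hν.integrable ((Function.hasTemperateGrowth_norm_sq F).comp hf)

end HasMoments

end Moments

section InnerProductSpace

variable {E : Type*} [NormedAddCommGroup E] [InnerProductSpace ℝ E]

lemma norm_cube (x : E) : ‖cube x‖ = ‖x‖ ^ 3 := by
  rw [cube, ContinuousLinearMap.norm_smulRight_apply]
  simp [pow_succ, mul_assoc]

lemma continuous_rankOne_self : Continuous fun x : E => rankOne ℝ x x :=
  (rankOne ℝ).continuous.clm_apply continuous_id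

lemma continuous_cube : Continuous fun x : E => cube x :=
  ((ContinuousLinearMap.smulRightL ℝ E (E →L[ℝ] E)).continuous.comp
    (innerSL ℝ).continuous).clm_apply continuous_rankOne_self

end InnerProductSpace

section Gaussian

lemma gaussianReal_conv_self (v : NNReal) :
    gaussianReal 0 v ∗ gaussianReal 0 v = (gaussianReal 0 v).map fun r => √2 * r := by
  rw [gaussianReal_conv_gaussianReal, gaussianReal_map_const_mul]
  congr 1
  · simp
  · ext
    simp [two_mul]

/-- For independent copies `R, R'` of a centered Gaussian, `𝔼(R + R')⁴` equals `4 𝔼R⁴` by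
`gaussianReal_conv_self` and `2 𝔼R⁴ + 6 v²` by expansion. -/
lemma integral_pow_four_gaussianReal (v : NNReal) :
    ∫ r, r ^ 4 ∂gaussianReal 0 v = 3 * (v : ℝ) ^ 2 := by
  set γ := gaussianReal 0 v
  have hγ {f : ℝ → ℝ} (hf : f.HasTemperateGrowth) : Integrable f γ :=
    (HasMoments.of_isGaussian γ).integrable hf
  have hmean : ∫ r, r ∂γ = 0 := integral_id_gaussianReal
  have hvar : ∫ r, r ^ 2 ∂γ = v := by
    rw [← variance_of_integral_eq_zero aemeasurable_id' hmean]
    exact variance_fun_id_gaussianReal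
  have hscale : ∫ r, r ^ 4 ∂(γ ∗ γ) = 4 * ∫ r, r ^ 4 ∂γ := by
    have hsqrt (r : ℝ) : (√2 * r) ^ 4 = 4 * r ^ 4 := by
      linear_combination (√2 ^ 2 + 2) * r ^ 4 * Real.sq_sqrt (zero_le_two (α := ℝ))
    have hconv : γ ∗ γ = γ.map fun r => √2 * r := gaussianReal_conv_self v
    rw [hconv, integral_map (by fun_prop) (by fun_prop), ← integral_const_mul]
    simp only [hsqrt]
  obtain ⟨m₃, hm₃⟩ : ∃ m, ∫ y, y ^ 3 ∂γ = m := ⟨_, rfl⟩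
  have hbinom (x : ℝ) : ∫ y, (x + y) ^ 4 ∂γ =
      x ^ 4 + 6 * v * x ^ 2 + 4 * m₃ * x + ∫ y, y ^ 4 ∂γ := by
    simp_rw [add_pow]
    rw [integral_finsetSum _ fun _ _ => hγ (by fun_prop)]
    simp only [integral_mul_const, integral_const_mul, Finset.sum_range_succ, Nat.choose]
    simp [hmean, hvar, hm₃]
    ring
  have hsum : ∫ r, r ^ 4 ∂(γ ∗ γ) = 2 * ∫ r, r ^ 4 ∂γ + 6 * (v : ℝ) ^ 2 := by
    have hconv_int : Integrable (fun r => r ^ 4) (γ ∗ γ) := by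
      rw [gaussianReal_conv_gaussianReal]
      exact (HasMoments.of_isGaussian _).integrable (by fun_prop)
    rw [integral_conv hconv_int]
    simp only [hbinom]
    rw [integral_add (hγ (by fun_prop)) (hγ (by fun_prop)),
      integral_add (hγ (by fun_prop)) (hγ (by fun_prop)),
      integral_add (hγ (by fun_prop)) (hγ (by fun_prop))]
    simp only [integral_const_mul, integral_const_mul (4 * m₃) fun x => x, hmean, hvar,
      integral_const, probReal_univ, one_smul]
    ring
  linarith

variable {E : Type*} [NormedAddCommGroup E] [InnerProductSpace ℝ E] [FiniteDimensional ℝ E]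
  [MeasurableSpace E] [BorelSpace E]

/-- `ν` is the Gaussian law with mean zero and covariance operator `A`. -/
structure IsCenteredGaussian (ν : Measure E) (A : E →L[ℝ] E) : Prop where
  isGaussian : IsGaussian ν
  integral_eq_zero : ∫ x, x ∂ν = 0
  integral_inner_mul_inner (y z : E) : ∫ x, inner ℝ y x * inner ℝ z x ∂ν = inner ℝ y (A z)

namespace IsCenteredGaussian

variable {ν : Measure E} {A : E →L[ℝ] E}

lemma hasMoments (hν : IsCenteredGaussian ν A) : HasMoments ν :=
  have := hν.isGaussian
  .of_isGaussian ν

lemma integral_inner_eq_zero (hν : IsCenteredGaussian ν A) (y : E) :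
    ∫ x, inner ℝ y x ∂ν = 0 := by
  have := hν.isGaussian
  rw [integral_inner IsGaussian.integrable_fun_id, hν.integral_eq_zero, inner_zero_right]

lemma variance_inner (hν : IsCenteredGaussian ν A) (y : E) :
    Var[fun x => inner ℝ y x; ν] = inner ℝ y (A y) := by
  rw [variance_of_integral_eq_zero (by fun_prop) (hν.integral_inner_eq_zero y)]
  simpa [pow_two] using hν.integral_inner_mul_inner y y

lemma map_inner (hν : IsCenteredGaussian ν A) (y : E) :
    ν.map (fun x => inner ℝ y x) = gaussianReal 0 (inner ℝ y (A y)).toNNReal := by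
  have := hν.isGaussian
  have hmap : ν.map (fun x => inner ℝ y x) =
      gaussianReal (∫ x, inner ℝ y x ∂ν) Var[fun x => inner ℝ y x; ν].toNNReal :=
    IsGaussian.map_eq_gaussianReal (innerSL ℝ y)
  rw [hmap, hν.integral_inner_eq_zero, hν.variance_inner]

lemma integral_inner_pow_four (hν : IsCenteredGaussian ν A) (y : E) :
    ∫ x, inner ℝ y x ^ 4 ∂ν = 3 * inner ℝ y (A y) ^ 2 := by
  have hvar : 0 ≤ inner ℝ y (A y) := hν.variance_inner y ▸ variance_nonneg _ _
  calc ∫ x, inner ℝ y x ^ 4 ∂ν = ∫ r, r ^ 4 ∂ν.map fun x => inner ℝ y x :=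
        (integral_map (f := fun r => r ^ 4) (by fun_prop) (by fun_prop)).symm
    _ = 3 * inner ℝ y (A y) ^ 2 := by
        rw [hν.map_inner, integral_pow_four_gaussianReal, Real.coe_toNNReal _ hvar]

lemma indepFun_inner (hν : IsCenteredGaussian ν A) {y z : E} (h : inner ℝ y (A z) = 0) :
    IndepFun (fun x => inner ℝ y x) (fun x => inner ℝ z x) ν := by
  have := hν.isGaussian
  refine HasGaussianLaw.indepFun_of_covariance_eq_zero
    (IsGaussian.hasGaussianLaw_id.map ((innerSL ℝ y).prod (innerSL ℝ z))) ?_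
  simpa [covariance, hν.integral_inner_eq_zero, hν.integral_inner_mul_inner] using h

lemma map_neg (hν : IsCenteredGaussian ν A) : ν.map (fun x => -x) = ν := by
  have := hν.isGaussian
  refine Measure.ext_of_charFun (funext fun t => ?_)
  have hmean : ∫ x, ((inner ℝ t x : ℝ) : ℂ) ∂ν = 0 := by
    rw [integral_complex_ofReal, hν.integral_inner_eq_zero, Complex.ofReal_zero]
  have hneg : charFun (ν.map fun x => -x) t = charFun ν (-t) := by
    rw [charFun_apply, charFun_apply, integral_map (by fun_prop) (by fun_prop)]
    simp
  rw [hneg, charFun_neg, IsGaussian.charFun_eq, hmean]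
  simp [← Complex.exp_conj, map_ofNat]

lemma integral_const_add (hν : IsCenteredGaussian ν A) {f : E → ℝ} (hf : f.HasTemperateGrowth)
    (c : E) : ∫ x, f (c + x) ∂ν = ∫ x, 2⁻¹ * (f (c + x) + f (c - x)) ∂ν := by
  have hcont : Continuous f := hf.1.continuous
  have hsymm : ∫ x, f (c - x) ∂ν = ∫ x, f (c + x) ∂ν := by
    conv_rhs => rw [← hν.map_neg, integral_map (by fun_prop) (by fun_prop)]
    simp only [← sub_eq_add_neg]
  have hadd : Integrable (fun x => f (c + x)) ν :=
    hν.hasMoments.integrable (hf.comp (f := fun x => c + x) (by fun_prop))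
  have hsub : Integrable (fun x => f (c - x)) ν :=
    hν.hasMoments.integrable (hf.comp (f := fun x => c - x) (by fun_prop))
  rw [integral_const_mul, integral_add hadd hsub, hsymm]
  ring

lemma integral_inner_const_add (hν : IsCenteredGaussian ν A) (c y : E) :
    ∫ x, inner ℝ y (c + x) ∂ν = inner ℝ y c := by
  have := hν.isGaussian
  rw [hν.integral_const_add (f := fun x => inner ℝ y x) (by fun_prop)]
  calc ∫ x, 2⁻¹ * (inner ℝ y (c + x) + inner ℝ y (c - x)) ∂ν = ∫ _x, inner ℝ y c ∂ν := by
        congr with x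
        rw [inner_add_right, inner_sub_right]
        ring
    _ = inner ℝ y c := by simp

lemma integral_inner_mul_inner_const_add (hν : IsCenteredGaussian ν A) (c y z : E) :
    ∫ x, inner ℝ y (c + x) * inner ℝ z (c + x) ∂ν =
      inner ℝ y c * inner ℝ z c + inner ℝ y (A z) := by
  have := hν.isGaussian
  have hint {f : E → ℝ} (hf : f.HasTemperateGrowth) : Integrable f ν := hν.hasMoments.integrable hf
  rw [hν.integral_const_add (f := fun x => inner ℝ y x * inner ℝ z x) (by fun_prop)]
  calc _ = ∫ x, inner ℝ y c * inner ℝ z c + inner ℝ y x * inner ℝ z x ∂ν := by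
        congr with x
        simp only [inner_add_right, inner_sub_right]
        ring
    _ = inner ℝ y c * inner ℝ z c + inner ℝ y (A z) := by
        rw [integral_add (hint (by fun_prop)) (hint (by fun_prop)), hν.integral_inner_mul_inner]
        simp

lemma integral_inner_mul_inner_mul_inner_const_add (hν : IsCenteredGaussian ν A) (c y z w : E) :
    ∫ x, inner ℝ y (c + x) * inner ℝ z (c + x) * inner ℝ w (c + x) ∂ν =
      inner ℝ y c * inner ℝ z c * inner ℝ w c + inner ℝ w c * inner ℝ y (A z) +
        inner ℝ z c * inner ℝ y (A w) + inner ℝ y c * inner ℝ z (A w) := by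
  have := hν.isGaussian
  have hint {f : E → ℝ} (hf : f.HasTemperateGrowth) : Integrable f ν := hν.hasMoments.integrable hf
  rw [hν.integral_const_add (f := fun x => inner ℝ y x * inner ℝ z x * inner ℝ w x) (by fun_prop)]
  calc _ = ∫ x, inner ℝ y c * inner ℝ z c * inner ℝ w c +
          inner ℝ w c * (inner ℝ y x * inner ℝ z x) + inner ℝ z c * (inner ℝ y x * inner ℝ w x) +
          inner ℝ y c * (inner ℝ z x * inner ℝ w x) ∂ν := by
        congr with x
        simp only [inner_add_right, inner_sub_right]
        ring
    _ = _ := by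
        rw [integral_add (hint (by fun_prop)) (hint (by fun_prop)),
          integral_add (hint (by fun_prop)) (hint (by fun_prop)),
          integral_add (hint (by fun_prop)) (hint (by fun_prop))]
        simp [integral_const_mul, hν.integral_inner_mul_inner]

lemma integral_inner_const_add_pow_four (hν : IsCenteredGaussian ν A) (c y : E) :
    ∫ x, inner ℝ y (c + x) ^ 4 ∂ν =
      inner ℝ y c ^ 4 + 6 * inner ℝ y c ^ 2 * inner ℝ y (A y) + 3 * inner ℝ y (A y) ^ 2 := by
  have := hν.isGaussian
  have hint {f : E → ℝ} (hf : f.HasTemperateGrowth) : Integrable f ν := hν.hasMoments.integrable hf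
  rw [hν.integral_const_add (f := fun x => inner ℝ y x ^ 4) (by fun_prop)]
  calc _ = ∫ x, inner ℝ y c ^ 4 + 6 * inner ℝ y c ^ 2 * (inner ℝ y x * inner ℝ y x) +
          inner ℝ y x ^ 4 ∂ν := by
        congr with x
        simp only [inner_add_right, inner_sub_right]
        ring
    _ = _ := by
        rw [integral_add (hint (by fun_prop)) (hint (by fun_prop)),
          integral_add (hint (by fun_prop)) (hint (by fun_prop))]
        simp [integral_const_mul, hν.integral_inner_mul_inner, hν.integral_inner_pow_four]

end IsCenteredGaussian

end Gaussian

section Mixture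

variable {E : Type*} [NormedAddCommGroup E] [InnerProductSpace ℝ E] [MeasurableSpace E]

/-- The mixture, with weights `a` and `1 - a`, of the translates of `ν` by `-(1 - a) h` and `a h`:
the two centers differ by `h` and their weighted mean is zero. -/
noncomputable def centeredMixture (a : unitInterval) (h : E) (ν : Measure E) : Measure E :=
  unitInterval.toNNReal a • ν.map (fun x => (-(1 - a : ℝ)) • h + x) +
    unitInterval.toNNReal (unitInterval.symm a) • ν.map (fun x => (a : ℝ) • h + x)

/-- The third central moment of a Bernoulli variable with success probability `1 - a`. -/
noncomputable def mixThird (a : ℝ) : ℝ := mixBeta a * (2 * a - 1)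

variable [BorelSpace E]

lemma isProbabilityMeasure_centeredMixture (a : unitInterval) (h : E) (ν : Measure E)
    [IsProbabilityMeasure ν] : IsProbabilityMeasure (centeredMixture a h ν) where
  measure_univ := by
    have hmap (c : E) : (ν.map fun x => c + x) Set.univ = 1 := by
      rw [Measure.map_apply (by fun_prop) .univ, Set.preimage_univ, measure_univ]
    simp [centeredMixture, hmap, -neg_sub, ← ENNReal.coe_add]

variable [FiniteDimensional ℝ E] {ν : Measure E} {A : E →L[ℝ] E} {a : unitInterval} {h : E}

namespace IsCenteredGaussian

lemma hasMoments_map_const_add (hν : IsCenteredGaussian ν A) (c : E) :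
    HasMoments (ν.map fun x => c + x) :=
  have := hν.isGaussian
  .of_isGaussian _

lemma hasMoments_centeredMixture (hν : IsCenteredGaussian ν A) (a : unitInterval) (h : E) :
    HasMoments (centeredMixture a h ν) :=
  ((hν.hasMoments_map_const_add _).smul_measure _).add_measure
    ((hν.hasMoments_map_const_add _).smul_measure _)

lemma integral_centeredMixture (hν : IsCenteredGaussian ν A) {f : E → ℝ}
    (hf : f.HasTemperateGrowth) :
    ∫ x, f x ∂centeredMixture a h ν =
      a * ∫ x, f ((-(1 - a : ℝ)) • h + x) ∂ν + (1 - a) * ∫ x, f ((a : ℝ) • h + x) ∂ν := by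
  have hcont : Continuous f := hf.1.continuous
  have hint (w : NNReal) (c : E) : Integrable f (w • ν.map fun x => c + x) :=
    ((hν.hasMoments_map_const_add c).smul_measure w).integrable hf
  rw [centeredMixture, integral_add_measure (hint _ _) (hint _ _), integral_smul_nnreal_measure,
    integral_smul_nnreal_measure, integral_map (by fun_prop) (by fun_prop),
    integral_map (by fun_prop) (by fun_prop)]
  rfl

lemma integral_inner_centeredMixture (hν : IsCenteredGaussian ν A) (y : E) :
    ∫ x, inner ℝ y x ∂centeredMixture a h ν = 0 := by
  rw [hν.integral_centeredMixture (by fun_prop), hν.integral_inner_const_add,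
    hν.integral_inner_const_add, real_inner_smul_right, real_inner_smul_right]
  ring

lemma integral_inner_mul_inner_centeredMixture (hν : IsCenteredGaussian ν A) (y z : E) :
    ∫ x, inner ℝ y x * inner ℝ z x ∂centeredMixture a h ν =
      inner ℝ y (A z) + mixBeta a * (inner ℝ y h * inner ℝ z h) := by
  rw [hν.integral_centeredMixture (by fun_prop), hν.integral_inner_mul_inner_const_add,
    hν.integral_inner_mul_inner_const_add]
  simp only [real_inner_smul_right, mixBeta]
  ring

lemma integral_inner_mul_inner_mul_inner_centeredMixture (hν : IsCenteredGaussian ν A)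
    (y z w : E) : ∫ x, inner ℝ y x * inner ℝ z x * inner ℝ w x ∂centeredMixture a h ν =
      mixThird a * (inner ℝ y h * inner ℝ z h * inner ℝ w h) := by
  rw [hν.integral_centeredMixture (by fun_prop), hν.integral_inner_mul_inner_mul_inner_const_add,
    hν.integral_inner_mul_inner_mul_inner_const_add]
  simp only [real_inner_smul_right, mixThird, mixBeta]
  ring

lemma integral_inner_pow_four_centeredMixture (hν : IsCenteredGaussian ν A) (y : E) :
    ∫ x, inner ℝ y x ^ 4 ∂centeredMixture a h ν =
      mixBeta a * (1 - 3 * mixBeta a) * inner ℝ y h ^ 4 +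
        6 * mixBeta a * inner ℝ y h ^ 2 * inner ℝ y (A y) + 3 * inner ℝ y (A y) ^ 2 := by
  rw [hν.integral_centeredMixture (by fun_prop), hν.integral_inner_const_add_pow_four,
    hν.integral_inner_const_add_pow_four]
  simp only [real_inner_smul_right, mixBeta]
  ring

lemma integral_id_centeredMixture (hν : IsCenteredGaussian ν A) :
    ∫ x, x ∂centeredMixture a h ν = 0 := by
  have hint : Integrable (fun x : E => x) (centeredMixture a h ν) :=
    (hν.hasMoments_centeredMixture a h).integrable (by fun_prop)
  refine ext_inner_left ℝ fun y => ?_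
  rw [← integral_inner hint, hν.integral_inner_centeredMixture, inner_zero_right]

/-- Multiplication by `g ⟪z, x⟫` factors out of the mixture integral because `⟪z, x⟫` has the same
law under both components and is independent of `⟪y, x⟫` within each. -/
lemma integral_comp_inner_mul_comp_inner_centeredMixture (hν : IsCenteredGaussian ν A) {y z : E}
    (hyz : inner ℝ y (A z) = 0) (hz : inner ℝ z h = 0) {f g : ℝ → ℝ} (hf : f.HasTemperateGrowth)
    (hg : g.HasTemperateGrowth) :
    ∫ x, f (inner ℝ y x) * g (inner ℝ z x) ∂centeredMixture a h ν =
      (∫ x, f (inner ℝ y x) ∂centeredMixture a h ν) * ∫ x, g (inner ℝ z x) ∂ν := by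
  have hfc : Continuous f := hf.1.continuous
  have hgc : Continuous g := hg.1.continuous
  have hfy : (fun x : E => f (inner ℝ y x)).HasTemperateGrowth := hf.comp (by fun_prop)
  have hfactor (s : ℝ) : ∫ x, f (s + inner ℝ y x) * g (inner ℝ z x) ∂ν =
      (∫ x, f (s + inner ℝ y x) ∂ν) * ∫ x, g (inner ℝ z x) ∂ν :=
    (hν.indepFun_inner hyz).integral_fun_comp_mul_comp (f := fun r => f (s + r)) (by fun_prop)
      (by fun_prop) (by fun_prop) (by fun_prop)
  rw [hν.integral_centeredMixture (by fun_prop), hν.integral_centeredMixture hfy]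
  simp only [inner_add_right, real_inner_smul_right, hz, mul_zero, zero_add, hfactor]
  ring

end IsCenteredGaussian

variable {A : E ≃L[ℝ] E} {θ : E}

lemma IsCenteredGaussian.integral_rankOne_centeredMixture
    (hν : IsCenteredGaussian ν (A : E →L[ℝ] E)) :
    ∫ x, rankOne ℝ x x ∂centeredMixture a (A θ) ν = popSecond A θ (mixBeta a) := by
  have hint := (hν.hasMoments_centeredMixture a (A θ)).integrable_of_norm_eq_pow (k := 2)
    continuous_rankOne_self fun x => by simp [pow_two]
  ext1 y
  rw [ContinuousLinearMap.integral_apply hint]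
  refine ext_inner_left ℝ fun z => ?_
  calc inner ℝ z (∫ x, rankOne ℝ x x y ∂centeredMixture a (A θ) ν) =
        ∫ x, inner ℝ z x * inner ℝ y x ∂centeredMixture a (A θ) ν := by
        rw [← integral_inner (hint.apply_continuousLinearMap y)]
        simp only [rankOne_apply, real_inner_smul_right, real_inner_comm y, mul_comm]
    _ = inner ℝ z (popSecond A θ (mixBeta a) y) := by
        rw [hν.integral_inner_mul_inner_centeredMixture, popSecond_apply, inner_add_right,
          real_inner_smul_right, real_inner_comm y, ContinuousLinearEquiv.coe_coe]
        ring

lemma IsCenteredGaussian.integral_cube_centeredMixture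
    (hν : IsCenteredGaussian ν (A : E →L[ℝ] E)) :
    ∫ x, cube x ∂centeredMixture a (A θ) ν = popThird A θ (mixThird a) := by
  have hint := (hν.hasMoments_centeredMixture a (A θ)).integrable_of_norm_eq_pow
    (F := E →L[ℝ] E →L[ℝ] E) continuous_cube norm_cube
  ext y w
  rw [ContinuousLinearMap.integral_apply hint,
    ContinuousLinearMap.integral_apply (hint.apply_continuousLinearMap y)]
  refine ext_inner_left ℝ fun z => ?_
  calc inner ℝ z (∫ x, cube x y w ∂centeredMixture a (A θ) ν) =
        ∫ x, inner ℝ y x * inner ℝ w x * inner ℝ z x ∂centeredMixture a (A θ) ν := by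
        rw [← integral_inner ((hint.apply_continuousLinearMap y).apply_continuousLinearMap w)]
        simp only [cube_apply, real_inner_smul_right, real_inner_comm y, real_inner_comm w]
    _ = inner ℝ z (popThird A θ (mixThird a) y w) := by
        rw [hν.integral_inner_mul_inner_mul_inner_centeredMixture, popThird_apply,
          real_inner_smul_right, real_inner_comm y, real_inner_comm w]
        ring

end Mixture

section Sample

variable {Ω E F : Type*} [MeasurableSpace Ω] {P : Measure Ω} [MeasurableSpace E]
  [TopologicalSpace E] [BorelSpace E] {ρ : Measure E} {Z : ℕ → Ω → E} [NormedAddCommGroup F]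

lemma ae_tendsto_avg [NormedSpace ℝ F] [CompleteSpace F] (hZ : ∀ i, HasLaw (Z i) ρ P)
    (hindep : iIndepFun Z P) {f : E → F} (hf : Continuous f) (hint : Integrable f ρ) :
    ∀ᵐ ω ∂P, Tendsto (fun n => avg n fun i => f (Z i ω)) atTop (𝓝 (∫ x, f x ∂ρ)) := by
  borelize F
  have hintZ : Integrable (fun ω => f (Z 0 ω)) P :=
    ((hZ 0).map_eq ▸ hint).comp_aemeasurable (hZ 0).aemeasurable
  have hmean : ∫ ω, f (Z 0 ω) ∂P = ∫ x, f x ∂ρ := (hZ 0).integral_comp hint.aestronglyMeasurable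
  rw [← hmean]
  exact strong_law_ae (fun i ω => f (Z i ω)) hintZ
    (fun i j hij => (hindep.indepFun hij).comp hf.measurable hf.measurable)
    fun i => ((hZ i).identDistrib (hZ 0)).comp hf.measurable

lemma sqrt_smul_avg [NormedSpace ℝ F] (n : ℕ) (f : ℕ → F) :
    √(n : ℝ) • avg n f = (√(n : ℝ))⁻¹ • ∑ i ∈ Finset.range n, f i := by
  rw [avg, smul_smul, ← div_eq_mul_inv, Real.sqrt_div_self]

variable [InnerProductSpace ℝ F] [FiniteDimensional ℝ F] [MeasurableSpace F] [BorelSpace F]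
  {μ : Measure F} [IsProbabilityMeasure μ] {C : F →L[ℝ] F} {r : ℝ}

theorem IsCenteredGaussian.tendstoInDistribution_sqrt_smul_avg [IsProbabilityMeasure P]
    (hμ : IsCenteredGaussian μ C) (hZ : ∀ i, HasLaw (Z i) ρ P) (hindep : iIndepFun Z P)
    {f : E → F} (hf : Continuous f) (hmem : MemLp f 2 ρ) (hmean : ∫ x, f x ∂ρ = 0)
    (hvar : ∀ t, r ^ 2 * inner ℝ t (C t) = ∫ x, inner ℝ t (f x) ^ 2 ∂ρ) :
    TendstoInDistribution (fun (n : ℕ) ω => √(n : ℝ) • avg n fun i => f (Z i ω)) atTop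
      (fun x => r • x) (fun _ => P) μ := by
  have := hμ.isGaussian
  have hmemZ : MemLp (fun ω => f (Z 0 ω)) 2 P :=
    ((hZ 0).map_eq ▸ hmem).comp_of_map (hZ 0).aemeasurable
  have hmeanZ : ∫ ω, f (Z 0 ω) ∂P = 0 := ((hZ 0).integral_comp hmem.1).trans hmean
  have hmeanμ : ∫ x, r • x ∂μ = 0 := by rw [integral_smul, hμ.integral_eq_zero, smul_zero]
  simp only [sqrt_smul_avg]
  refine tendstoInDistribution_inv_sqrt_smul_sum (Y := fun i ω => f (Z i ω))
    (hindep.comp (fun _ => f) fun _ => hf.measurable)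
    (fun i => ((hZ i).identDistrib (hZ 0)).comp hf.measurable) hmemZ hmeanZ
    (IsGaussian.hasGaussianLaw_id.fun_smul r) hmeanμ fun t => ?_
  have hmeanZ_t : ∫ ω, inner ℝ t (f (Z 0 ω)) ∂P = 0 := by
    rw [integral_inner (hmemZ.integrable one_le_two), hmeanZ, inner_zero_right]
  have hvarZ : Var[fun ω => inner ℝ t (f (Z 0 ω)); P] = ∫ x, inner ℝ t (f x) ^ 2 ∂ρ := by
    rw [variance_of_integral_eq_zero (hmemZ.const_inner t).aemeasurable hmeanZ_t]
    exact (hZ 0).integral_comp (f := fun x => inner ℝ t (f x) ^ 2) ((hmem.const_inner t).1.pow 2)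
  simp only [real_inner_smul_right]
  rw [variance_const_mul, hμ.variance_inner, hvar, hvarZ]

end Sample

section MixtureSample

variable {Ω E : Type*} [MeasurableSpace Ω] {P : Measure Ω} [NormedAddCommGroup E]
  [InnerProductSpace ℝ E] [FiniteDimensional ℝ E] [MeasurableSpace E] [BorelSpace E]
  {ν : Measure E} {A : E ≃L[ℝ] E} {a : unitInterval} {θ : E} {Z : ℕ → Ω → E}

lemma IsCenteredGaussian.ae_momentsTendsto (hν : IsCenteredGaussian ν (A : E →L[ℝ] E))
    (hZ : ∀ i, HasLaw (Z i) (centeredMixture a (A θ) ν) P) (hindep : iIndepFun Z P) :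
    ∀ᵐ ω ∂P, MomentsTendsto (fun i => Z i ω) (popSecond A θ (mixBeta a))
      (popThird A θ (mixThird a)) := by
  have hmom := hν.hasMoments_centeredMixture a (A θ)
  have hmean := ae_tendsto_avg hZ hindep continuous_id (hmom.integrable (by fun_prop))
  have hsecond := ae_tendsto_avg hZ hindep continuous_rankOne_self
    (hmom.integrable_of_norm_eq_pow (k := 2) continuous_rankOne_self fun x => by simp [pow_two])
  have hthird := ae_tendsto_avg hZ hindep continuous_cube
    (hmom.integrable_of_norm_eq_pow (F := E →L[ℝ] E →L[ℝ] E) continuous_cube norm_cube)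
  rw [hν.integral_rankOne_centeredMixture] at hsecond
  rw [hν.integral_cube_centeredMixture] at hthird
  simp only [id, hν.integral_id_centeredMixture] at hmean
  filter_upwards [hmean, hsecond, hthird] with ω h₁ h₂ h₃ using ⟨h₁, h₂, h₃⟩

lemma IsCenteredGaussian.integral_inner_smul_projInv (hν : IsCenteredGaussian ν (A : E →L[ℝ] E))
    (hA : IsPosDef A) {f g : ℝ → ℝ} (hf : f.HasTemperateGrowth) (hg : g.HasTemperateGrowth)
    (t : E) :
    ∫ x, f (inner ℝ (normalize θ) x) * g (inner ℝ t (projInv A θ x)) ∂centeredMixture a (A θ) ν =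
      (∫ x, f (inner ℝ (normalize θ) x) ∂centeredMixture a (A θ) ν) *
        ∫ x, g (inner ℝ t (projInv A θ x)) ∂ν := by
  have hθ : inner ℝ θ ((ℝ ∙ θ)ᗮ.starProjection t) = 0 :=
    Submodule.mem_orthogonal_singleton_iff_inner_right.1 (Submodule.starProjection_apply_mem _ t)
  simp only [hA.inner_projInv]
  refine hν.integral_comp_inner_mul_comp_inner_centeredMixture ?_ ?_ hf hg
  · rw [NormedSpace.normalize, real_inner_smul_left, A.coe_coe, A.apply_symm_apply, hθ, mul_zero]
  · rw [← hA.symm, A.apply_symm_apply, real_inner_comm, hθ]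

theorem IsCenteredGaussian.tendstoInDistribution_sqrt_smul_avg_projInv [IsProbabilityMeasure P]
    {μ : Measure E} [IsProbabilityMeasure μ] {q r : ℝ}
    (hμ : IsCenteredGaussian μ (q • (projInv A θ ∘L (ℝ ∙ θ)ᗮ.starProjection)))
    (hν : IsCenteredGaussian ν (A : E →L[ℝ] E)) (hA : IsPosDef A)
    (hZ : ∀ i, HasLaw (Z i) (centeredMixture a (A θ) ν) P) (hindep : iIndepFun Z P)
    {f : ℝ → ℝ} (hf : f.HasTemperateGrowth)
    (hr : r ^ 2 * q = ∫ x, f (inner ℝ (normalize θ) x) ^ 2 ∂centeredMixture a (A θ) ν) :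
    TendstoInDistribution (fun (n : ℕ) ω => √(n : ℝ) • avg n fun i =>
        f (inner ℝ (normalize θ) (Z i ω)) • projInv A θ (Z i ω)) atTop
      (fun x => r • x) (fun _ => P) μ := by
  have hmom := hν.hasMoments_centeredMixture a (A θ)
  have hfΓ : (fun x => f (inner ℝ (normalize θ) x) • projInv A θ x).HasTemperateGrowth := by
    fun_prop
  refine hμ.tendstoInDistribution_sqrt_smul_avg hZ hindep hfΓ.1.continuous (hmom.memLp_two hfΓ)
    (ext_inner_left ℝ fun t => ?_) fun t => ?_
  · rw [← integral_inner (hmom.integrable hfΓ), inner_zero_right]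
    simp only [real_inner_smul_right]
    rw [hν.integral_inner_smul_projInv hA hf (g := fun s => s) (by fun_prop)]
    simp only [hA.inner_projInv, hν.integral_inner_eq_zero, mul_zero]
  · simp only [real_inner_smul_right, mul_pow]
    rw [hν.integral_inner_smul_projInv hA (f := fun s => f s ^ 2) (g := fun s => s ^ 2)
      (by fun_prop) (by fun_prop), ← hr]
    simp only [hA.inner_projInv, pow_two, hν.integral_inner_mul_inner, smul_apply,
      ContinuousLinearMap.comp_apply, real_inner_smul_right, ContinuousLinearEquiv.coe_coe,
      ContinuousLinearEquiv.apply_symm_apply]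
    ring

end MixtureSample

section LimitingVariance

lemma HasMoments.integral_quadratic_sq {E : Type*} [NormedAddCommGroup E] [InnerProductSpace ℝ E]
    [MeasurableSpace E] [BorelSpace E] [SecondCountableTopology E] {ρ : Measure E}
    [IsProbabilityMeasure ρ] (hρ : HasMoments ρ) {y : E} {b k : ℝ}
    (h₁ : ∫ x, inner ℝ y x ∂ρ = 0) (h₂ : ∫ x, inner ℝ y x ^ 2 ∂ρ = b)
    (h₃ : ∫ x, inner ℝ y x ^ 3 ∂ρ = k) :
    ∫ x, (b * inner ℝ y x ^ 2 - k * inner ℝ y x - b ^ 2) ^ 2 ∂ρ =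
      b * (b * (∫ x, inner ℝ y x ^ 4 ∂ρ) - k ^ 2 - b ^ 3) := by
  have hint {f : E → ℝ} (hf : f.HasTemperateGrowth) : Integrable f ρ := hρ.integrable hf
  calc _ = ∫ x, b ^ 2 * inner ℝ y x ^ 4 + (k ^ 2 - 2 * b ^ 3) * inner ℝ y x ^ 2 + b ^ 4
          - 2 * b * k * inner ℝ y x ^ 3 + 2 * k * b ^ 2 * inner ℝ y x ∂ρ := by
        congr with x
        ring
    _ = _ := by
        rw [integral_add (hint (by fun_prop)) (hint (by fun_prop)),
          integral_sub (hint (by fun_prop)) (hint (by fun_prop)),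
          integral_add (hint (by fun_prop)) (hint (by fun_prop)),
          integral_add (hint (by fun_prop)) (hint (by fun_prop))]
        simp only [integral_const_mul, h₁, h₂, h₃, integral_const, probReal_univ, one_smul]
        ring

/-- The factor of `(I - θ θ' / ‖θ‖²) S⁻¹ (I - θ θ' / ‖θ‖²)` in `PsiGamma`, in terms of `β`, `τ` and
`m = ‖θ‖`. -/
noncomputable def limitFactor (β τ m : ℝ) : ℝ :=
  Cgamma β τ * ((1 + β * τ) / (m ^ 2 * β))

lemma limitFactor_pos {β τ m : ℝ} (hβ : 0 < β) (hβ' : 0 < 1 - 4 * β) (hτ : 0 < τ) (hm : 0 < m) :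
    0 < limitFactor β τ m := by
  rw [limitFactor, Cgamma]
  positivity

variable {E : Type*} [NormedAddCommGroup E] [InnerProductSpace ℝ E] [FiniteDimensional ℝ E]
  [MeasurableSpace E] [BorelSpace E] {ν : Measure E} {A : E ≃L[ℝ] E} {a : unitInterval} {θ : E}

lemma one_sub_four_mul_mixBeta (a : ℝ) : 1 - 4 * mixBeta a = (2 * a - 1) ^ 2 := by
  rw [mixBeta]
  ring

/-- The weight of the observation `x` in the linearized `score`, as a function of the projection
`r` of `x` on `normalize θ`; it is independent of `projInv A θ x`. -/
noncomputable def scoreWeight (A : E ≃L[ℝ] E) (θ : E) (a r : ℝ) : ℝ :=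
  popVar A θ (mixBeta a) * r ^ 2 - popSkew A θ (mixThird a) * r - popVar A θ (mixBeta a) ^ 2

lemma IsCenteredGaussian.integral_scoreWeight_sq (hν : IsCenteredGaussian ν (A : E →L[ℝ] E))
    (hA : IsPosDef A) (hθ : θ ≠ 0) (hβ : mixBeta a ≠ 0) (ha : 2 * (a : ℝ) - 1 ≠ 0) :
    ∫ x, scoreWeight A θ a (inner ℝ (normalize θ) x) ^ 2 ∂centeredMixture a (A θ) ν =
      popSkew A θ (mixThird a) ^ 2 * limitFactor (mixBeta a) (inner ℝ (A θ) θ) ‖θ‖ := by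
  have := hν.isGaussian
  have := isProbabilityMeasure_centeredMixture a (A θ) ν
  have hτ := (hA.pos θ hθ).ne'
  have hnorm := norm_ne_zero_iff.2 hθ
  have hsecond : ∫ x, inner ℝ (normalize θ) x ^ 2 ∂centeredMixture a (A θ) ν =
      popVar A θ (mixBeta a) := by
    rw [popVar, inner_popSecond, real_inner_comm (normalize θ) (A _),
      real_inner_comm (normalize θ) (A _)]
    simp only [pow_two, hν.integral_inner_mul_inner_centeredMixture, A.coe_coe]
  have hthird : ∫ x, inner ℝ (normalize θ) x ^ 3 ∂centeredMixture a (A θ) ν =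
      popSkew A θ (mixThird a) := by
    rw [popSkew, inner_popThird, real_inner_comm (normalize θ)]
    simp only [pow_succ, pow_zero, one_mul, hν.integral_inner_mul_inner_mul_inner_centeredMixture]
  have hmean_u : inner ℝ (normalize θ) (A θ) = inner ℝ (A θ) θ / ‖θ‖ := by
    rw [NormedSpace.normalize, real_inner_smul_left, real_inner_comm, inv_mul_eq_div]
  have hvar_u : inner ℝ (normalize θ) (A (normalize θ)) = inner ℝ (A θ) θ / ‖θ‖ ^ 2 := by
    simp only [NormedSpace.normalize, map_smul, real_inner_smul_left, real_inner_smul_right,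
      real_inner_comm θ]
    ring
  simp only [scoreWeight]
  rw [(hν.hasMoments_centeredMixture a (A θ)).integral_quadratic_sq
    (hν.integral_inner_centeredMixture _) hsecond hthird,
    hν.integral_inner_pow_four_centeredMixture, A.coe_coe, hmean_u, hvar_u, popVar_eq, popSkew_eq,
    limitFactor, Cgamma, one_sub_four_mul_mixBeta, mixThird]
  have hrel := one_sub_four_mul_mixBeta a
  generalize mixBeta a = β at *
  generalize 2 * (a : ℝ) - 1 = d at *
  generalize inner ℝ (A θ) θ = τ at *
  obtain rfl : β = (1 - d ^ 2) / 4 := by linarith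
  have hd : 1 - d ^ 2 ≠ 0 := by grind
  field_simp
  ring

end LimitingVariance

section ScoreLimit

variable {E : Type*} [NormedAddCommGroup E] [InnerProductSpace ℝ E]

/-- The coefficients of the averages of `⟪u, x i⟫ ^ j • projInv A θ (x i)`, `j ≤ 2`, in the `score`
of the sample `x` at `v`, where `u = normalize θ`. -/
noncomputable def scoreCoeff (x : ℕ → E) (u v : E) (n : ℕ) : Fin 3 → ℝ :=
  ![inner ℝ (centralThird x n v v) v * avg n (fun i => inner ℝ u (x i))
      + inner ℝ (centralSecond x n v) v *
        (2 * avg n (fun i => inner ℝ u (x i)) ^ 2 - avg n (fun i => inner ℝ u (x i) ^ 2)),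
    -(inner ℝ (centralThird x n v v) v
      + 2 * inner ℝ (centralSecond x n v) v * avg n (fun i => inner ℝ u (x i))),
    inner ℝ (centralSecond x n v) v]

lemma score_eq_sum_scoreCoeff_smul (A : E ≃L[ℝ] E) (θ : E) (x : ℕ → E) (v : E) (n : ℕ) :
    score A θ (centralSecond x n) (centralThird x n) v =
      ∑ j : Fin 3, scoreCoeff x (normalize θ) v n j •
        avg n fun i => inner ℝ (normalize θ) (x i) ^ (j : ℕ) • projInv A θ (x i) := by
  have hproj (r : ℕ → ℝ) (y : ℕ → E) : projInv A θ (avg n fun i => r i • y i) =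
      avg n fun i => r i • projInv A θ (y i) := by
    simpa using map_avg (projInv A θ).toLinearMap n fun i => r i • y i
  have hproj' : projInv A θ (avg n x) = avg n fun i => projInv A θ (x i) :=
    map_avg (projInv A θ).toLinearMap n x
  rw [score, centralThird_apply x n (normalize θ), centralSecond_apply x n (normalize θ)]
  simp only [avg_sub_avg_mul_smul, avg_sub_avg_smul, real_inner_comm (normalize θ), map_add,
    map_sub, map_smul, hproj, hproj', Fin.sum_univ_three, scoreCoeff, Matrix.cons_val,
    Fin.val_zero, Fin.val_one, Fin.val_two, pow_zero, pow_one, pow_two, one_smul]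
  module

lemma MomentsTendsto.tendsto_scoreCoeff [FiniteDimensional ℝ E] {A : E ≃L[ℝ] E} {θ : E} {β c : ℝ}
    {x v : ℕ → E} (h : MomentsTendsto x (popSecond A θ β) (popThird A θ c))
    (hv : Tendsto v atTop (𝓝 (normalize θ))) (j : Fin 3) :
    Tendsto (fun n => scoreCoeff x (normalize θ) (v n) n j) atTop
      (𝓝 (![-popVar A θ β ^ 2, -popSkew A θ c, popVar A θ β] j)) := by
  have hmean : Tendsto (fun n => avg n fun i => inner ℝ (normalize θ) (x i)) atTop (𝓝 0) := by
    simpa only [real_inner_comm (normalize θ)] using h.tendsto_avg_inner (normalize θ)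
  have hsq : Tendsto (fun n => avg n fun i => inner ℝ (normalize θ) (x i) ^ 2) atTop
      (𝓝 (popVar A θ β)) := by
    simpa only [inner_avg, real_inner_smul_left, fun i => real_inner_comm (normalize θ) (x i),
      pow_two, popVar] using (h.tendsto_avg_inner_smul (normalize θ)).inner (𝕜 := ℝ)
        (tendsto_const_nhds (x := normalize θ))
  have hvar : Tendsto (fun n => inner ℝ (centralSecond x n (v n)) (v n)) atTop
      (𝓝 (popVar A θ β)) := (tendsto_clm_apply h.tendsto_centralSecond hv).inner hv
  have hskew : Tendsto (fun n => inner ℝ (centralThird x n (v n) (v n)) (v n)) atTop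
      (𝓝 (popSkew A θ c)) :=
    (tendsto_clm_apply (tendsto_clm_apply h.tendsto_centralThird hv) hv).inner hv
  have h₀ := (hskew.mul hmean).add (hvar.mul (((hmean.pow 2).const_mul 2).sub hsq))
  have h₁ := (hskew.add ((hvar.const_mul 2).mul hmean)).neg
  fin_cases j
  · simpa [scoreCoeff, pow_two] using h₀
  · simpa [scoreCoeff] using h₁
  · simpa [scoreCoeff] using hvar

variable [MeasurableSpace E] [BorelSpace E] [FiniteDimensional ℝ E] {Ω : Type*}
  [MeasurableSpace Ω] {P : Measure Ω}

lemma aemeasurable_scoreCoeff {Z : ℕ → Ω → E} (hZ : ∀ i, AEMeasurable (Z i) P)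
    {v : Ω → E} (hv : AEMeasurable v P) (u : E) (n : ℕ) (j : Fin 3) :
    AEMeasurable (fun ω => scoreCoeff (fun i => Z i ω) u (v ω) n j) P := by
  fin_cases j <;>
    simp only [scoreCoeff, centralSecond_apply, centralThird_apply, avg, Matrix.cons_val,
      Fin.zero_eta, Fin.mk_one, Fin.reduceFinMk] <;>
    fun_prop

variable {ν μ : Measure E} [IsProbabilityMeasure P] [IsProbabilityMeasure μ] {A : E ≃L[ℝ] E}
  {a : unitInterval} {θ : E} {Z v : ℕ → Ω → E}

theorem IsCenteredGaussian.tendstoInDistribution_score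
    (hμ : IsCenteredGaussian μ (limitFactor (mixBeta a) (inner ℝ (A θ) θ) ‖θ‖ •
      (projInv A θ ∘L (ℝ ∙ θ)ᗮ.starProjection)))
    (hν : IsCenteredGaussian ν (A : E →L[ℝ] E)) (hA : IsPosDef A) (hθ : θ ≠ 0)
    (hβ : 0 < mixBeta a) (ha : 2 * (a : ℝ) - 1 ≠ 0)
    (hZ : ∀ i, HasLaw (Z i) (centeredMixture a (A θ) ν) P) (hindep : iIndepFun Z P)
    (hvm : ∀ n, AEMeasurable (v n) P)
    (hv : ∀ᵐ ω ∂P, Tendsto (fun n => v n ω) atTop (𝓝 (normalize θ))) :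
    TendstoInDistribution (fun (n : ℕ) ω => √(n : ℝ) •
        score A θ (centralSecond (fun i => Z i ω) n) (centralThird (fun i => Z i ω) n) (v n ω))
      atTop (fun x => popSkew A θ (mixThird a) • x) (fun _ => P) μ := by
  set q := limitFactor (mixBeta a) (inner ℝ (A θ) θ) ‖θ‖
  have hq : 0 < q := limitFactor_pos hβ (one_sub_four_mul_mixBeta a ▸ by positivity)
    (hA.pos θ hθ) (norm_pos_iff.2 hθ)
  have hpow (j : Fin 3) := hμ.tendstoInDistribution_sqrt_smul_avg_projInv hν hA hZ hindep
    (f := fun r => r ^ (j : ℕ)) (by fun_prop)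
    (r := √((∫ x, (inner ℝ (normalize θ) x ^ (j : ℕ)) ^ 2 ∂centeredMixture a (A θ) ν) / q))
    (by rw [Real.sq_sqrt (by positivity), div_mul_cancel₀ _ hq.ne'])
  have hweight := hμ.tendstoInDistribution_sqrt_smul_avg_projInv hν hA hZ hindep
    (f := scoreWeight A θ a) (by unfold scoreWeight; fun_prop)
    (hν.integral_scoreWeight_sq hA hθ hβ.ne' ha).symm
  have hcoeff (j : Fin 3) : ∀ᵐ ω ∂P, Tendsto
      (fun n => scoreCoeff (fun i => Z i ω) (normalize θ) (v n ω) n j) atTop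
      (𝓝 (![-popVar A θ (mixBeta a) ^ 2, -popSkew A θ (mixThird a),
        popVar A θ (mixBeta a)] j)) := by
    filter_upwards [hν.ae_momentsTendsto hZ hindep, hv] with ω hω hvω
      using hω.tendsto_scoreCoeff hvω j
  have hsum := tendstoInDistribution_sum_smul (s := .univ) (fun j _ => hpow j)
    (fun j _ n => aemeasurable_scoreCoeff (fun i => (hZ i).aemeasurable) (hvm n) _ n j)
    (fun j _ => hcoeff j)
    (hweight.congr (fun n => .of_forall fun ω => ?_) (.of_forall fun _ => rfl))
  · simpa only [score_eq_sum_scoreCoeff_smul, Finset.smul_sum, smul_comm (√_)] using hsum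
  · simp only [scoreWeight, sub_smul, mul_smul, avg_sub, avg_const_smul,
      Fin.sum_univ_three, Matrix.cons_val, Fin.val_zero, Fin.val_one, Fin.val_two, pow_zero,
      pow_one, one_smul]
    module

end ScoreLimit

section Covariance

variable {ι : Type*} [Fintype ι] [DecidableEq ι] {S : Matrix ι ι ℝ}

open Matrix (toEuclideanCLM)

lemma isCenteredGaussian_multivariateGaussian (hS : S.PosSemidef) :
    IsCenteredGaussian (multivariateGaussian 0 S) (toEuclideanCLM (𝕜 := ℝ) S) where
  isGaussian := inferInstance
  integral_eq_zero := integral_id_multivariateGaussian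
  integral_inner_mul_inner y z := by
    have hmean (t : EuclideanSpace ℝ ι) : ∫ x, inner ℝ t x ∂multivariateGaussian 0 S = 0 := by
      rw [integral_inner IsGaussian.integrable_fun_id, integral_id_multivariateGaussian,
        inner_zero_right]
    rw [Matrix.inner_toEuclideanCLM, ← covarianceBilin_multivariateGaussian hS,
      covarianceBilin_apply_eq_cov IsGaussian.memLp_two_id, covariance, hmean, hmean]
    simp

/-- A positive definite matrix as an invertible operator on Euclidean space. -/
noncomputable def posDefEquiv (hS : S.PosDef) : EuclideanSpace ℝ ι ≃L[ℝ] EuclideanSpace ℝ ι :=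
  have hdet := (Matrix.isUnit_iff_isUnit_det S).1 hS.isUnit
  .equivOfInverse' (toEuclideanCLM (𝕜 := ℝ) S) (toEuclideanCLM (𝕜 := ℝ) S⁻¹)
    (by rw [← ContinuousLinearMap.mul_def, ← map_mul, Matrix.mul_nonsing_inv _ hdet, map_one]; rfl)
    (by rw [← ContinuousLinearMap.mul_def, ← map_mul, Matrix.nonsing_inv_mul _ hdet, map_one]; rfl)

lemma isPosDef_posDefEquiv (hS : S.PosDef) : IsPosDef (posDefEquiv hS) where
  symm := (hS.isHermitian.isSelfAdjoint.map (toEuclideanCLM (𝕜 := ℝ))).isSymmetric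
  pos y hy := by
    rw [real_inner_comm]
    exact (Matrix.inner_toEuclideanCLM S y y).symm ▸
      hS.dotProduct_mulVec_pos (x := y.ofLp) (by simpa using hy)

end Covariance

section Mixture

variable {p : ℕ}

lemma multivariateGaussian_eq_map {ι : Type*} [Fintype ι] [DecidableEq ι] (m : EuclideanSpace ℝ ι)
    (S : Matrix ι ι ℝ) :
    multivariateGaussian m S = (multivariateGaussian 0 S).map (fun x => m + x) := by
  rw [multivariateGaussian, multivariateGaussian, Measure.map_map (by fun_prop) (by fun_prop)]
  simp only [Function.comp_def, zero_add]

variable (a : unitInterval) (μ₁ μ₂ : Vec p) (S : Matrix (Fin p) (Fin p) ℝ)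

lemma xLaw_eq_add : xLaw a μ₁ μ₂ S = unitInterval.toNNReal a • multivariateGaussian μ₁ S +
    unitInterval.toNNReal (unitInterval.symm a) • multivariateGaussian μ₂ S := by
  have : IsMarkovKernel (Kernel.ofFunOfCountable
      (fun y : ℕ => multivariateGaussian ((y : ℝ) • μ₁ + (1 - (y : ℝ)) • μ₂) S)) :=
    ⟨fun y => inferInstanceAs (IsProbabilityMeasure (multivariateGaussian _ S))⟩
  rw [xLaw, pairLaw, Measure.snd_compProd]
  ext s hs
  rw [Measure.bind_apply hs (Kernel.aemeasurable _), bernoulliMeasure_def, lintegral_add_measure,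
    lintegral_smul_measure, lintegral_smul_measure, lintegral_dirac, lintegral_dirac]
  simp [Kernel.ofFunOfCountable]

/-- The mean of the mixture `xLaw`. -/
noncomputable def mixMean (a : ℝ) (μ₁ μ₂ : Vec p) : Vec p := a • μ₁ + (1 - a) • μ₂

lemma map_sub_mixMean_xLaw : (xLaw a μ₁ μ₂ S).map (fun x => x - mixMean a μ₁ μ₂) =
    centeredMixture a (μ₂ - μ₁) (multivariateGaussian 0 S) := by
  have hfirst (x : Vec p) : μ₁ + x - mixMean a μ₁ μ₂ = (-(1 - a : ℝ)) • (μ₂ - μ₁) + x := by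
    rw [mixMean]
    module
  have hsecond (x : Vec p) : μ₂ + x - mixMean a μ₁ μ₂ = (a : ℝ) • (μ₂ - μ₁) + x := by
    rw [mixMean]
    module
  rw [xLaw_eq_add, multivariateGaussian_eq_map μ₁, multivariateGaussian_eq_map μ₂,
    Measure.map_add _ _ (by fun_prop), Measure.map_smul, Measure.map_smul,
    Measure.map_map (by fun_prop) (by fun_prop), Measure.map_map (by fun_prop) (by fun_prop)]
  simp only [Function.comp_def, hfirst, hsecond]
  rfl

lemma hasLaw_sub_mixMean {Ω : Type*} [MeasurableSpace Ω] {P : Measure Ω} {a : unitInterval}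
    {μ₁ μ₂ : Vec p} {S : Matrix (Fin p) (Fin p) ℝ} {X : Ω → Vec p}
    (hX : HasLaw X (xLaw a μ₁ μ₂ S) P) :
    HasLaw (fun ω => X ω - mixMean a μ₁ μ₂)
      (centeredMixture a (μ₂ - μ₁) (multivariateGaussian 0 S)) P :=
  HasLaw.fun_comp (Y := fun x => x - mixMean a μ₁ μ₂)
    ⟨by fun_prop, map_sub_mixMean_xLaw a μ₁ μ₂ S⟩ hX

end Mixture

section Discriminant

open Matrix (toEuclideanCLM)

variable {p : ℕ} {a : unitInterval} {μ₁ μ₂ : Vec p} {S : Matrix (Fin p) (Fin p) ℝ}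

lemma toEuclideanCLM_orthProj (θ : Vec p) :
    toEuclideanCLM (𝕜 := ℝ) (orthProj θ) = (ℝ ∙ θ)ᗮ.starProjection := by
  have hvecMul (y : Vec p) :
      Matrix.vecMulVec θ.ofLp θ.ofLp *ᵥ y.ofLp = inner ℝ θ y • θ.ofLp := by
    ext i
    simp [Matrix.vecMulVec_mulVec, PiLp.inner_apply, dotProduct, mul_comm]
  ext y i
  rw [starProjection_orthogonal_singleton]
  simp [orthProj, hvecMul, mul_assoc]

lemma isHermitian_orthProj (θ : Vec p) : (orthProj θ).IsHermitian := by
  ext i j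
  simp [orthProj, Matrix.vecMulVec, Matrix.one_apply, mul_comm, eq_comm]

lemma posDefEquiv_discriminant (hS : S.PosDef) :
    posDefEquiv hS (discriminant μ₁ μ₂ S) = μ₂ - μ₁ :=
  (posDefEquiv hS).apply_symm_apply (μ₂ - μ₁)

lemma discriminant_ne_zero (hS : S.PosDef) (hμ : μ₁ ≠ μ₂) : discriminant μ₁ μ₂ S ≠ 0 := by
  intro h
  simpa [h, sub_eq_zero, eq_comm, hμ] using posDefEquiv_discriminant (μ₁ := μ₁) (μ₂ := μ₂) hS

lemma mahalanobisSq_eq_inner (hS : S.PosDef) : mahalanobisSq μ₁ μ₂ S =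
    inner ℝ (posDefEquiv hS (discriminant μ₁ μ₂ S)) (discriminant μ₁ μ₂ S) := by
  rw [posDefEquiv_discriminant]
  exact (Matrix.inner_toEuclideanCLM S⁻¹ _ _).symm

lemma PsiGamma_eq_limitFactor_smul (a : ℝ) (μ₁ μ₂ : Vec p) (S : Matrix (Fin p) (Fin p) ℝ) :
    PsiGamma a μ₁ μ₂ S =
      limitFactor (mixBeta a) (mahalanobisSq μ₁ μ₂ S) ‖discriminant μ₁ μ₂ S‖ •
        (orthProj (discriminant μ₁ μ₂ S) * S⁻¹ * orthProj (discriminant μ₁ μ₂ S)) := by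
  rw [PsiGamma, PsiU, smul_smul, limitFactor]

lemma posSemidef_PsiGamma (hS : S.PosDef) (hμ : μ₁ ≠ μ₂) (hβ : 0 < mixBeta a)
    (ha : 2 * (a : ℝ) - 1 ≠ 0) : (PsiGamma a μ₁ μ₂ S).PosSemidef := by
  have hθ := discriminant_ne_zero hS hμ
  have hconj := hS.inv.posSemidef.conjTranspose_mul_mul_same (orthProj (discriminant μ₁ μ₂ S))
  rw [(isHermitian_orthProj _).eq] at hconj
  rw [PsiGamma_eq_limitFactor_smul, mahalanobisSq_eq_inner hS]
  exact hconj.smul (limitFactor_pos hβ (one_sub_four_mul_mixBeta a ▸ by positivity)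
    ((isPosDef_posDefEquiv hS).pos _ hθ) (norm_pos_iff.2 hθ)).le

lemma toEuclideanCLM_PsiGamma (hS : S.PosDef) (a : ℝ) :
    let θ := discriminant μ₁ μ₂ S
    toEuclideanCLM (𝕜 := ℝ) (PsiGamma a μ₁ μ₂ S) =
      limitFactor (mixBeta a) (inner ℝ (posDefEquiv hS θ) θ) ‖θ‖ •
        (projInv (posDefEquiv hS) θ ∘L (ℝ ∙ θ)ᗮ.starProjection) := by
  rw [PsiGamma_eq_limitFactor_smul, mahalanobisSq_eq_inner hS, map_smul, map_mul, map_mul,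
    toEuclideanCLM_orthProj]
  rfl

end Discriminant

section Main

variable {Ω E : Type*} [MeasurableSpace Ω] {P : Measure Ω} [NormedAddCommGroup E]
  [InnerProductSpace ℝ E] [MeasurableSpace E] [BorelSpace E]

lemma exists_measurable_sign_smul_inner_nonneg [SecondCountableTopology E] {u : Ω → E}
    (hu : AEMeasurable u P) (w : E) :
    ∃ s : Ω → ℝ, Measurable s ∧ (∀ ω, s ω = -1 ∨ s ω = 1) ∧ ∀ᵐ ω ∂P, 0 ≤ inner ℝ (s ω • u ω) w := by
  classical
  refine ⟨fun ω => if 0 ≤ inner ℝ (hu.mk u ω) w then 1 else -1,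
    .ite (measurableSet_le measurable_const (hu.measurable_mk.inner measurable_const))
      measurable_const measurable_const, fun ω => (ite_eq_or_eq _ _ _).symm, ?_⟩
  filter_upwards [hu.ae_eq_mk] with ω hω
  rw [real_inner_smul_left, ← hω]
  split_ifs with h
  · rwa [one_mul]
  · linarith

variable [FiniteDimensional ℝ E] {ν μ : Measure E} {A : E ≃L[ℝ] E} {a : unitInterval} {θ : E}
  {Z v : ℕ → Ω → E}

theorem IsCenteredGaussian.ae_tendsto_of_isMaxSkewness (hν : IsCenteredGaussian ν (A : E →L[ℝ] E))
    (hA : IsPosDef A) (hθ : θ ≠ 0) (hc : mixThird a ≠ 0)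
    (hZ : ∀ i, HasLaw (Z i) (centeredMixture a (A θ) ν) P) (hindep : iIndepFun Z P)
    (hmax : ∀ᵐ ω ∂P, ∀ᶠ n in atTop, ‖v n ω‖ = 1 ∧
      IsMaxSkewness (centralSecond (fun i => Z i ω) n) (centralThird (fun i => Z i ω) n) (v n ω))
    (hpos : ∀ᵐ ω ∂P, ∀ n, 0 ≤ inner ℝ (v n ω) (normalize θ)) :
    ∀ᵐ ω ∂P, Tendsto (fun n => v n ω) atTop (𝓝 (normalize θ)) := by
  filter_upwards [hν.ae_momentsTendsto hZ hindep, hmax, hpos] with ω hmom hmaxω hposω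
  exact hA.tendsto_normalize_of_isMaxSkewness hθ hc hmom.tendsto_centralSecond
    hmom.tendsto_centralThird (hmaxω.mono fun _ h => h.2) (hmaxω.mono fun _ h => h.1)
    (.of_forall hposω)

theorem IsCenteredGaussian.tendstoInDistribution_of_isMaxSkewness [IsProbabilityMeasure P]
    [IsProbabilityMeasure μ]
    (hμ : IsCenteredGaussian μ (limitFactor (mixBeta a) (inner ℝ (A θ) θ) ‖θ‖ •
      (projInv A θ ∘L (ℝ ∙ θ)ᗮ.starProjection)))
    (hν : IsCenteredGaussian ν (A : E →L[ℝ] E)) (hA : IsPosDef A) (hθ : θ ≠ 0)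
    (hβ : 0 < mixBeta a) (ha : 2 * (a : ℝ) - 1 ≠ 0)
    (hZ : ∀ i, HasLaw (Z i) (centeredMixture a (A θ) ν) P) (hindep : iIndepFun Z P)
    (hvm : ∀ n, AEMeasurable (v n) P)
    (hmax : ∀ᵐ ω ∂P, ∀ᶠ n in atTop, ‖v n ω‖ = 1 ∧
      IsMaxSkewness (centralSecond (fun i => Z i ω) n) (centralThird (fun i => Z i ω) n) (v n ω))
    (hv : ∀ᵐ ω ∂P, Tendsto (fun n => v n ω) atTop (𝓝 (normalize θ))) :
    TendstoInDistribution (fun (n : ℕ) ω => √(n : ℝ) • (v n ω - normalize θ)) atTop id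
      (fun _ => P) μ := by
  have hc : mixThird a ≠ 0 := mul_ne_zero hβ.ne' ha
  have hscore := (hμ.tendstoInDistribution_score hν hA hθ hβ ha hZ hindep hvm hv).continuous_comp
    (g := fun x => (popSkew A θ (mixThird a))⁻¹ • x) (by fun_prop)
  simp only [Function.comp_def, inv_smul_smul₀ (hA.popSkew_ne_zero hθ hc)] at hscore
  refine tendstoInDistribution_of_isEquivalent hscore
    (fun n => ((hvm n).sub_const _).fun_const_smul _) ?_
  filter_upwards [hν.ae_momentsTendsto hZ hindep, hmax, hv] with ω hmom hmaxω hvω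
  simp only [smul_comm (popSkew A θ (mixThird a))⁻¹]
  exact Asymptotics.IsEquivalent.refl.smul (hA.isEquivalent_smul_score hθ hβ.le hc
    hmom.tendsto_centralSecond hmom.tendsto_centralThird (isSymmetricMoments_central _)
    (hmaxω.mono fun _ h => h.2) (hmaxω.mono fun _ h => h.1) hvω)

end Main

end SkewnessPP

open SkewnessPP in
theorem mainTheorem3 {Ω : Type*} [MeasurableSpace Ω] (P : Measure Ω) [IsProbabilityMeasure P]
    {p : ℕ} (α₁ : unitInterval) (hα0 : (0 : ℝ) < α₁) (hα1 : (α₁ : ℝ) < 1)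
    (hα : (α₁ : ℝ) ≠ 1 / 2)
    (μ₁ μ₂ : EuclideanSpace ℝ (Fin p)) (hμ : μ₁ ≠ μ₂)
    (S : Matrix (Fin p) (Fin p) ℝ) (hS : S.PosDef)
    (X : ℕ → Ω → EuclideanSpace ℝ (Fin p))
    (hX : ∀ i, HasLaw (X i) (SkewnessPP.xLaw α₁ μ₁ μ₂ S) P) (hindep : iIndepFun X P)
    (u : ℕ → Ω → EuclideanSpace ℝ (Fin p)) (hu : ∀ n, AEMeasurable (u n) P)
    (humax : ∀ᵐ ω ∂P, ∀ᶠ n in atTop,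
      SkewnessPP.IsSkewnessMaximizer (fun i => X i ω) n (u n ω)) :
    (SkewnessPP.PsiGamma α₁ μ₁ μ₂ S).PosSemidef ∧
    ∃ s : ℕ → Ω → ℝ, (∀ n, Measurable (s n)) ∧ (∀ n ω, s n ω = -1 ∨ s n ω = 1) ∧
      (∀ᵐ ω ∂P, Tendsto (fun n => s n ω • u n ω) atTop
        (𝓝 (SkewnessPP.unitDiscriminant μ₁ μ₂ S))) ∧
      TendstoInDistribution
        (fun (n : ℕ) ω => √(n : ℝ) • (s n ω • u n ω - SkewnessPP.unitDiscriminant μ₁ μ₂ S))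
        atTop id (fun _ => P)
        (multivariateGaussian 0 (SkewnessPP.PsiGamma α₁ μ₁ μ₂ S)) := by
  have hβ : 0 < mixBeta α₁ := mul_pos hα0 (sub_pos.2 hα1)
  have ha : 2 * (α₁ : ℝ) - 1 ≠ 0 := fun h => hα (by linarith)
  have hA := isPosDef_posDefEquiv hS
  have hθ := discriminant_ne_zero hS hμ
  have hΨ := posSemidef_PsiGamma hS hμ hβ ha
  have hG := isCenteredGaussian_multivariateGaussian hS.posSemidef
  have hlimit := isCenteredGaussian_multivariateGaussian hΨ
  rw [toEuclideanCLM_PsiGamma hS] at hlimit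
  have hZ (i : ℕ) := hasLaw_sub_mixMean (hX i)
  rw [← posDefEquiv_discriminant hS] at hZ
  have hZindep := hindep.comp (fun _ x => x - mixMean α₁ μ₁ μ₂) fun _ => by fun_prop
  choose s hs hsign hpos using fun n =>
    exists_measurable_sign_smul_inner_nonneg (hu n) (unitDiscriminant μ₁ μ₂ S)
  have hmax : ∀ᵐ ω ∂P, ∀ᶠ n in atTop, ‖s n ω • u n ω‖ = 1 ∧
      IsMaxSkewness (centralSecond (fun i => X i ω - mixMean α₁ μ₁ μ₂) n)
        (centralThird (fun i => X i ω - mixMean α₁ μ₁ μ₂) n) (s n ω • u n ω) := by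
    filter_upwards [humax] with ω hω
    filter_upwards [hω] with n hn
    have hunit : ‖u n ω‖ = 1 := by simpa using hn.1
    exact ⟨by rcases hsign n ω with h | h <;> simp [h, hunit],
      (hn.sub_const _).isMaxSkewness.const_smul _⟩
  have hlim := hG.ae_tendsto_of_isMaxSkewness hA hθ (mul_ne_zero hβ.ne' ha) hZ hZindep hmax
    (ae_all_iff.2 hpos)
  exact ⟨hΨ, s, hs, hsign, hlim, hlimit.tendstoInDistribution_of_isMaxSkewness hG hA hθ hβ ha hZ
    hZindep (fun n => (hs n).aemeasurable.smul (hu n)) hmax hlim⟩
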